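/- All rings are commutative with $1$. A *pair of rings* $(B,A)$ is a ring $B$ with a subring $A$; a homomorphism $(B,A)\to(B',A')$ is a ring homomorphism $\varphi:B\to B'$ with $\varphi(A)\subset A'$. This gives the category *pa-Rings*. Let $Nor_BA$ be the integral closure of $A$ in $B$; the *relative normalizations* are the homomorphisms $id_B:(B,A)\to(B,Nor_BA)$. A valuation on $B$ is a map $v:B\to\Gamma\cup\{0\}$, with $\Gamma$ a totally ordered abelian group (written multiplicatively) generated by the nonzero values of $v$, such that $v(0)=0$, $v(1)=1$, $v(xy)=v(x)v(y)$ and $v(x+y)\le\max\{v(x),v(y)\}$; equivalent valuations are identified. $Spa(B,A)$ is the set of valuations on $B$ with $v(a)\le 1$ for all $a\in A$, with the topology generated by the sets $\{v: v(a)\le v(b)\ne 0\}$, $a,b\in B$, and $Val(B,A)\subset Spa(B,A)$ is the subspace of those $v$ that are unbounded, i.e. for no $\gamma\in\Gamma$ is $v(b)<\gamma$ for all $b\in B$. The retraction $r:Spa(B,A)\to Val(B,A)$ sends $v$ to the valuation equal to $v(b)$ if $v(b)\in c\Gamma_v$ and to $0$ otherwise, where $c\Gamma_v$ is the convex subgroup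 of $\Gamma$ generated by the values $v(b)\ge 1$. For $b,a_1,\dots,a_n\in B$ generating the unit ideal, the rational domain $\{v\in Val(B,A): v(a_i)\le v(b)\ \forall i\}$ is assigned the ring $B_b$ and its subring $Nor_{B_b}\big(\varphi_b(A)[\tfrac{a_1}{b},\dots,\tfrac{a_n}{b}]\big)$, where $\varphi_b:B\to B_b$ is the canonical map. The associated sheaves on $Val(B,A)$ are denoted $\mathcal M\supset\mathcal O$; their sections are regarded as functions with values in the local rings $B_{\mathfrak p}$, $\mathfrak p=\ker v$. A *pair-ringed space* is a topological space with a sheaf of rings $\mathcal M$ and a subsheaf of rings $\mathcal O\subset\mathcal M$; a morphism is a continuous map $h$ with a morphism of sheaves of rings $h^\sharp:\mathcal M_Y\to h_*\mathcal M_X$ carrying $\mathcal O_Y$ into $h_*\mathcal O_X$. An *affinoid birational space* is a pair-ringed space isomorphic to $Val(B,A)$ for some pair $(B,A)$. The category *af-Birat* has these as objects, and as morphisms the morphisms of pair-ringed spaces that induce local homomorphisms on the stalks of $\mathcal O$. The functor $bir:\textit{pa-Rings}^{op}\to\textit{af-Birat}$ sends $(B,A)$ to $Val(B,A)$ and $\varphi:(B,A)\to(B',A')$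 to the morphism $\varphi_{bir}:Val(B',A')\to Val(B,A)$ given on points by $v\mapsto r(v\circ\varphi)$ and on sections by the maps $B_{\ker\varphi_{bir}(v)}\to B'_{\ker v}$ induced by $\varphi$. **Theorem.** The functor $bir$ inverts the relative normalizations, and the functor it induces from the localization of pa-Rings at the class of relative normalizations to $\textit{af-Birat}^{op}$ is an equivalence of categories; that is, $bir$ is an anti-equivalence between the localized category and af-Birat. Moreover, for every pair $(B,A)$ the canonical map $B\to\Gamma(Val(B,A),\mathcal M)$ is bijective and identifies $Nor_BA$ with $\Gamma(Val(B,A),\mathcal O)$; and, for all pairs $(B,A)$ and $(B',A')$, taking global sections is a bijection from the set of morphisms of affinoid birational spaces $Val(B,A)\to Val(B',A')$ onto the set of ring homomorphisms $B'\to B$ carrying $Nor_{B'}A'$ into $Nor_BA$. -/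

import Mathlib

open CategoryTheory Opposite TopologicalSpace

universe u

noncomputable section

namespace Birational

/-- A pair of rings `(B, A)`: a commutative ring `B` with a subring `A`. -/
structure PaRing : Type (u + 1) where
  B : Type u
  [ring : CommRing B]
  A : Subring B

namespace PaRing

attribute [instance] PaRing.ring

/-- A homomorphism of pairs `(B, A) → (B', A')`: a ring map `B → B'` carrying `A` into `A'`. -/
@[ext]
structure Hom (P Q : PaRing.{u}) : Type u where
  toRingHom : P.B →+* Q.B
  map_mem : ∀ a ∈ P.A, toRingHom a ∈ Q.A

instance : Category.{u} PaRing.{u} where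
  Hom P Q := Hom P Q
  id P := ⟨RingHom.id P.B, fun _ => id⟩
  comp f g := ⟨g.toRingHom.comp f.toRingHom, fun _ h => g.map_mem _ (f.map_mem _ h)⟩

/-- The pair `(B, Nor_B A)`, where `Nor_B A` is the integral closure of `A` in `B`. -/
def nor (P : PaRing.{u}) : PaRing.{u} := ⟨P.B, (integralClosure P.A P.B).toSubring⟩

lemma mem_nor {P : PaRing.{u}} {x : P.B} : x ∈ P.nor.A ↔ IsIntegral P.A x := Iff.rfl

lemma le_nor (P : PaRing.{u}) : P.A ≤ P.nor.A := fun a ha =>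
  mem_nor.2 (isIntegral_algebraMap (R := P.A) (x := ⟨a, ha⟩))

/-- The relative normalization homomorphism `(B, A) → (B, Nor_B A)`, which is the identity on `B`. -/
def toNor (P : PaRing.{u}) : P ⟶ P.nor := ⟨RingHom.id P.B, fun _ ha => P.le_nor ha⟩

/-- The class of relative normalization homomorphisms. -/
def relNormalizations : MorphismProperty PaRing.{u} := MorphismProperty.ofHoms toNor

lemma Hom.map_nor {P Q : PaRing.{u}} (f : P.Hom Q) {x : P.B} (hx : x ∈ P.nor.A) :
    f.toRingHom x ∈ Q.nor.A := by
  have h : IsIntegral P.A x := hx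
  let g : P.A →+* Q.A := f.toRingHom.restrict P.A Q.A f.map_mem
  obtain ⟨p, hp, h0⟩ := h
  refine ⟨p.map g, hp.map g, ?_⟩
  rw [Polynomial.eval₂_map]
  have : (algebraMap Q.A Q.B).comp g = f.toRingHom.comp (algebraMap P.A P.B) := rfl
  rw [this, ← Polynomial.hom_eval₂, h0, map_zero]

end PaRing

/-- The set `Spa(B, A)` of `A`-valuations on `B`, i.e. valuations `v` with `v a ≤ 1` for `a ∈ A`,
up to equivalence. The equivalence class of `v` is Mathlib's `ValuativeRel`, i.e. the relation
`vle a b ↔ v a ≤ v b`. -/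
@[ext]
structure Spa (P : PaRing.{u}) : Type u where
  rel : ValuativeRel P.B
  vle_one : ∀ a ∈ P.A, rel.vle a 1

namespace Spa

variable {P Q : PaRing.{u}}

/-- The value group (with zero adjoined) of `v`; it is generated by the nonzero values of `v`. -/
abbrev Γ₀ (v : Spa P) : Type u := letI := v.rel; ValuativeRel.ValueGroupWithZero P.B

/-- The valuation `B → Γ ∪ {0}` (canonical representative of the equivalence class `v`). -/
def val (v : Spa P) : Valuation P.B v.Γ₀ := letI := v.rel; ValuativeRel.valuation P.B

lemma vle_iff (v : Spa P) (a b : P.B) : v.rel.vle a b ↔ v.val a ≤ v.val b := by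
  let := v.rel
  exact Valuation.vle_iff_le (ValuativeRel.valuation P.B)

lemma val_le_one (v : Spa P) {a : P.B} (ha : a ∈ P.A) : v.val a ≤ 1 := by
  rw [← map_one v.val, ← vle_iff]; exact v.vle_one a ha

lemma ext_val {v w : Spa P} (h : ∀ a b, v.val a ≤ v.val b ↔ w.val a ≤ w.val b) : v = w := by
  apply Spa.ext
  apply ValuativeRel.ext
  funext a b
  exact propext (by rw [vle_iff, vle_iff, h])

lemma exists_div (v : Spa P) (γ : v.Γ₀) :
    ∃ a s : P.B, v.val s ≠ 0 ∧ γ = v.val a / v.val s := by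
  let := v.rel
  obtain ⟨a, s, h⟩ := ValuativeRel.exists_valuation_div_valuation_eq (R := P.B) γ
  exact ⟨a, s, ValuativeRel.valuation_posSubmonoid_ne_zero s, h.symm⟩

/-- The class of a valuation which is at most `1` on `A`. -/
def ofValuation {Γ : Type*} [LinearOrderedCommGroupWithZero Γ] (v : Valuation P.B Γ)
    (h : ∀ a ∈ P.A, v a ≤ 1) : Spa P where
  rel := ValuativeRel.ofValuation v
  vle_one a ha := show v a ≤ v 1 by rw [map_one]; exact h a ha

lemma ofValuation_le_iff {Γ : Type*} [LinearOrderedCommGroupWithZero Γ] (v : Valuation P.B Γ)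
    (h : ∀ a ∈ P.A, v a ≤ 1) (a b : P.B) :
    (ofValuation v h).val a ≤ (ofValuation v h).val b ↔ v a ≤ v b :=
  ((ofValuation v h).vle_iff a b).symm

/-- The kernel of `v`, a prime ideal of `B`. -/
def ker (v : Spa P) : Ideal P.B := v.val.supp

instance (v : Spa P) : v.ker.IsPrime := inferInstanceAs v.val.supp.IsPrime

lemma mem_ker {v : Spa P} {b : P.B} : b ∈ v.ker ↔ v.val b = 0 := Valuation.mem_supp_iff _ _

/-- The topology generated by the sets `U_{a,b} = {v | v a ≤ v b ≠ 0}`. -/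
instance : TopologicalSpace (Spa P) :=
  TopologicalSpace.generateFrom
    {S | ∃ a b : P.B, S = {v : Spa P | v.val a ≤ v.val b ∧ v.val b ≠ 0}}

/-- The pull back map `φ^* v = v ∘ φ`. -/
def comap (φ : P ⟶ Q) (v : Spa Q) : Spa P :=
  ofValuation (v.val.comap φ.toRingHom) fun a ha => v.val_le_one (φ.map_mem a ha)

lemma comap_le_iff (φ : P ⟶ Q) (v : Spa Q) (a b : P.B) :
    (comap φ v).val a ≤ (comap φ v).val b ↔
      v.val (φ.toRingHom a) ≤ v.val (φ.toRingHom b) :=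
  ofValuation_le_iff _ _ a b

/-- `v` is bounded if some `γ ∈ Γ` satisfies `v b < γ` for all `b ∈ B`. -/
def Bounded (v : Spa P) : Prop := ∃ γ : v.Γ₀ˣ, ∀ b, v.val b < γ

/-- The subgroup `cΓ_v`: the convex subgroup of `Γ` generated by the values `v b ≥ 1`. -/
def cGamma (v : Spa P) : Subgroup v.Γ₀ˣ :=
  sInf {H | (H : Set v.Γ₀ˣ).OrdConnected ∧
    ∀ (γ : v.Γ₀ˣ) (b : P.B), (γ : v.Γ₀) = v.val b → 1 ≤ v.val b → γ ∈ H}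

/-- `v b` lies in `cΓ_v`. -/
def InC (v : Spa P) (b : P.B) : Prop := ∃ γ ∈ v.cGamma, (γ : v.Γ₀) = v.val b

lemma inC_iff (v : Spa P) (b : P.B) : v.InC b ↔ ∃ c, 1 ≤ v.val (b * c) := by
  constructor
  · rintro ⟨γ, hγ, hb⟩
    let H : Subgroup v.Γ₀ˣ :=
      { carrier := {γ | ∃ c, 1 ≤ v.val c ∧ (γ : v.Γ₀) ≤ v.val c ∧ (γ⁻¹ : v.Γ₀) ≤ v.val c}
        one_mem' := ⟨1, by simp⟩
        mul_mem' := by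
          rintro x y ⟨c, h1, h2, h3⟩ ⟨d, k1, k2, k3⟩
          refine ⟨c * d, ?_, ?_, ?_⟩
          · rw [map_mul]; exact one_le_mul h1 k1
          · rw [map_mul, Units.val_mul]; exact mul_le_mul' h2 k2
          · rw [map_mul, Units.val_mul, mul_inv]; exact mul_le_mul' h3 k3
        inv_mem' := by
          rintro x ⟨c, h1, h2, h3⟩
          exact ⟨c, h1, by simpa using h3, by simpa using h2⟩ }
    have hH : v.cGamma ≤ H := by
      apply sInf_le
      refine ⟨⟨?_⟩, ?_⟩
      · rintro x ⟨c, h1, h2, h3⟩ y ⟨d, k1, k2, k3⟩ z ⟨hxz, hzy⟩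
        refine ⟨c * d, ?_, ?_, ?_⟩
        · rw [map_mul]; exact one_le_mul h1 k1
        · rw [map_mul]
          exact (Units.val_le_val.2 hzy).trans (k2.trans (le_mul_of_one_le_left' h1))
        · rw [map_mul]
          refine le_trans ?_ (h3.trans (le_mul_of_one_le_right' k1))
          have := inv_le_inv_iff.2 hxz
          simpa using Units.val_le_val.2 this
      · intro γ b h1 h2
        refine ⟨b, h2, h1.le, ?_⟩
        rw [h1]
        exact (inv_le_one_of_one_le₀ h2).trans h2
    obtain ⟨c, h1, h2, h3⟩ := hH hγ
    refine ⟨c, ?_⟩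
    rw [map_mul, ← hb]
    calc (1 : v.Γ₀) = γ * (γ⁻¹ : v.Γ₀) := by simp
      _ ≤ _ := by gcongr
  · rintro ⟨c, hc⟩
    have hb0 : v.val b ≠ 0 := by
      intro h
      rw [map_mul, h, zero_mul] at hc
      exact absurd hc (not_le.2 zero_lt_one)
    refine ⟨Units.mk0 _ hb0, ?_, rfl⟩
    rw [cGamma, Subgroup.mem_sInf]
    rintro H ⟨hH, hmem⟩
    rcases le_total 1 (v.val b) with h | h
    · exact hmem _ b rfl h
    · have hc0 : v.val c ≠ 0 := by
        intro h'
        rw [map_mul, h', mul_zero] at hc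
        exact absurd hc (not_le.2 zero_lt_one)
      have h1c : 1 ≤ v.val c := by
        rw [map_mul] at hc
        exact hc.trans (mul_le_of_le_one_left' h)
      have hcH := hmem (Units.mk0 _ hc0) c rfl h1c
      refine hH.out (H.inv_mem hcH) H.one_mem ⟨?_, ?_⟩
      · rw [← Units.val_le_val]
        simp only [Units.val_inv_eq_inv_val, Units.val_mk0]
        rw [map_mul] at hc
        exact (inv_le_iff_one_le_mul₀ (zero_lt_iff.2 hc0)).2 hc
      · rw [← Units.val_le_val]; simpa using h

lemma inC_of_le (v : Spa P) {a b : P.B} (h : v.val a ≤ v.val b) (ha : v.InC a) : v.InC b := by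
  rw [inC_iff] at ha ⊢
  obtain ⟨c, hc⟩ := ha
  exact ⟨c, hc.trans (by rw [map_mul, map_mul]; gcongr)⟩

lemma inC_mul (v : Spa P) (a b : P.B) : v.InC (a * b) ↔ v.InC a ∧ v.InC b := by
  simp only [inC_iff]
  constructor
  · rintro ⟨c, hc⟩
    exact ⟨⟨b * c, by rwa [← mul_assoc]⟩, ⟨a * c, by rwa [mul_left_comm, ← mul_assoc]⟩⟩
  · rintro ⟨⟨c, hc⟩, ⟨d, hd⟩⟩
    refine ⟨c * d, ?_⟩
    rw [mul_mul_mul_comm, map_mul]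
    exact one_le_mul hc hd

lemma inC_one (v : Spa P) : v.InC 1 := (v.inC_iff 1).2 ⟨1, by simp⟩

open Classical in
/-- The minimal primary specialization of `v`: the valuation with `v' b = v b` if `v b ∈ cΓ_v`
and `v' b = 0` otherwise. -/
def minSpec (v : Spa P) : Valuation P.B v.Γ₀ where
  toFun b := if v.InC b then v.val b else 0
  map_zero' := by simp
  map_one' := by simp [inC_one]
  map_mul' a b := by
    simp only [inC_mul]
    by_cases ha : v.InC a <;> by_cases hb : v.InC b <;> simp [ha, hb]
  map_add_le_max' a b := by
    by_cases h : v.InC (a + b)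
    · rw [if_pos h]
      rcases le_max_iff.1 (v.val.map_add a b) with h' | h'
      · rw [if_pos (v.inC_of_le h' h)]; exact le_max_of_le_left h'
      · rw [if_pos (v.inC_of_le h' h)]; exact le_max_of_le_right h'
    · rw [if_neg h]; exact zero_le

open Classical in
lemma minSpec_apply (v : Spa P) (b : P.B) : v.minSpec b = if v.InC b then v.val b else 0 := rfl

lemma minSpec_le (v : Spa P) (b : P.B) : v.minSpec b ≤ v.val b := by
  rw [minSpec_apply]; split_ifs <;> simp

/-- The class in `Spa(B, A)` of the minimal primary specialization of `v`. -/
def retract (v : Spa P) : Spa P :=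
  ofValuation v.minSpec fun a ha => (v.minSpec_le a).trans (v.val_le_one ha)

lemma retract_le_iff (v : Spa P) (a b : P.B) :
    v.retract.val a ≤ v.retract.val b ↔ ((∃ c, 1 ≤ v.val (a * c)) → v.val a ≤ v.val b) := by
  rw [retract, ofValuation_le_iff, minSpec_apply, minSpec_apply, ← inC_iff]
  constructor
  · intro h ha
    rw [if_pos ha] at h
    refine h.trans ?_
    split_ifs <;> simp
  · intro h
    by_cases ha : v.InC a
    · rw [if_pos ha, if_pos (v.inC_of_le (h ha) ha)]; exact h ha
    · rw [if_neg ha]; exact zero_le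

lemma one_le_retract_iff (v : Spa P) (b : P.B) : 1 ≤ v.retract.val b ↔ 1 ≤ v.val b := by
  rw [← map_one v.retract.val, retract_le_iff, map_one]
  exact ⟨fun h => h ⟨1, by simp⟩, fun h _ => h⟩

lemma not_bounded_iff (v : Spa P) :
    ¬ v.Bounded ↔ ∀ s, v.val s ≠ 0 → ∃ c, 1 ≤ v.val (s * c) := by
  constructor
  · intro h s hs
    by_contra! hc
    apply h
    refine ⟨(Units.mk0 _ hs)⁻¹, fun b => ?_⟩
    have := hc b
    rw [map_mul] at this
    simp only [Units.val_inv_eq_inv_val, Units.val_mk0]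
    rw [← not_le, inv_le_iff_one_le_mul₀ (zero_lt_iff.2 hs), not_le, mul_comm]
    exact this
  · rintro h ⟨γ, hγ⟩
    obtain ⟨a, s, hs, hγ'⟩ := v.exists_div γ
    obtain ⟨c, hc⟩ := h s hs
    have := hγ (a * c)
    rw [hγ', lt_div_iff₀ (zero_lt_iff.2 hs), ← map_mul] at this
    refine absurd this (not_lt.2 ?_)
    rw [show a * c * s = a * (s * c) by ring, map_mul]
    exact le_mul_of_one_le_right' hc

lemma retract_ne_zero_iff (v : Spa P) (b : P.B) :
    v.retract.val b ≠ 0 ↔ ∃ c, 1 ≤ v.val (b * c) := by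
  rw [← not_iff_not, not_not, ← le_zero_iff, ← map_zero v.retract.val, retract_le_iff]
  constructor
  · rintro h h'
    obtain ⟨c, hc⟩ := h'
    have h0 := h ⟨c, hc⟩
    rw [map_zero, le_zero_iff] at h0
    rw [map_mul, h0, zero_mul] at hc
    exact absurd hc (not_le.2 zero_lt_one)
  · exact fun h h' => absurd h' h

lemma retract_unbounded (v : Spa P) : ¬ v.retract.Bounded := by
  rw [not_bounded_iff]
  intro s hs
  obtain ⟨c, hc⟩ := (v.retract_ne_zero_iff s).1 hs
  exact ⟨c, (v.one_le_retract_iff _).2 hc⟩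

lemma retract_eq_self {v : Spa P} (h : ¬ v.Bounded) : v.retract = v := by
  rw [not_bounded_iff] at h
  apply ext_val
  intro a b
  rw [retract_le_iff]
  refine ⟨fun h' => ?_, fun h' _ => h'⟩
  by_cases ha : v.val a = 0
  · rw [ha]; exact zero_le
  · exact h' (h a ha)

end Spa

/-- The space `Val(B, A)` of unbounded `A`-valuations on `B`, with the subspace topology. -/
def Val (P : PaRing.{u}) : Type u := {v : Spa P // ¬ v.Bounded}

namespace Val

variable {P Q R : PaRing.{u}}

instance : TopologicalSpace (Val P) := inferInstanceAs (TopologicalSpace {v : Spa P // ¬ v.Bounded})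

/-- The retraction `r : Spa(B, A) → Val(B, A)` to the minimal primary specialization. -/
def r (v : Spa P) : Val P := ⟨v.retract, v.retract_unbounded⟩

lemma continuous_r : Continuous (r : Spa P → Val P) := by
  apply Continuous.subtype_mk
  apply continuous_generateFrom_iff.2
  rintro _ ⟨a, b, rfl⟩
  have : Spa.retract ⁻¹' {v : Spa P | v.val a ≤ v.val b ∧ v.val b ≠ 0} =
      {v : Spa P | v.val a ≤ v.val b ∧ v.val b ≠ 0} ∩
        ⋃ c, {v : Spa P | v.val 1 ≤ v.val (b * c) ∧ v.val (b * c) ≠ 0} := by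
    ext v
    simp only [Set.mem_preimage, Set.mem_ofPred_eq, Spa.retract_le_iff, Spa.retract_ne_zero_iff,
      Set.mem_inter_iff, Set.mem_iUnion, map_one]
    constructor
    · rintro ⟨h, c, hc⟩
      have hbc : v.val (b * c) ≠ 0 := fun h0 => by
        rw [h0] at hc; exact absurd hc (not_le.2 zero_lt_one)
      have hb0 : v.val b ≠ 0 := fun h0 => hbc (by rw [map_mul, h0, zero_mul])
      refine ⟨⟨?_, hb0⟩, c, hc, hbc⟩
      by_contra! hlt
      exact absurd (h ⟨c, hc.trans (by rw [map_mul, map_mul]; gcongr)⟩) (not_le.2 hlt)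
    · rintro ⟨⟨h, _⟩, c, hc, _⟩
      exact ⟨fun _ => h, c, hc⟩
  rw [this]
  have hU : ∀ a b : P.B, IsOpen {v : Spa P | v.val a ≤ v.val b ∧ v.val b ≠ 0} := fun a b =>
    isOpen_generateFrom_of_mem ⟨a, b, rfl⟩
  exact (hU a b).inter (isOpen_iUnion fun c => hU 1 (b * c))

lemma continuous_comap (φ : P ⟶ Q) : Continuous (Spa.comap φ) := by
  apply continuous_generateFrom_iff.2
  rintro _ ⟨a, b, rfl⟩
  refine isOpen_generateFrom_of_mem ⟨φ.toRingHom a, φ.toRingHom b, ?_⟩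
  ext v
  simp only [Set.mem_preimage, Set.mem_ofPred_eq, Spa.comap_le_iff]
  refine and_congr Iff.rfl (not_congr ?_)
  rw [← le_zero_iff, ← map_zero (Spa.comap φ v).val, Spa.comap_le_iff, map_zero, map_zero,
    le_zero_iff]

/-- The map of spaces `φ_bir = r ∘ φ^* : Val(B', A') → Val(B, A)`. -/
def birMap (φ : P ⟶ Q) (v : Val Q) : Val P := r (Spa.comap φ v.1)

lemma continuous_birMap (φ : P ⟶ Q) : Continuous (birMap φ) :=
  continuous_r.comp ((continuous_comap φ).comp continuous_subtype_val)

lemma birMap_le_iff (φ : P ⟶ Q) (v : Val Q) (a b : P.B) :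
    (birMap φ v).1.val a ≤ (birMap φ v).1.val b ↔
      ((∃ c, 1 ≤ v.1.val (φ.toRingHom (a * c))) →
        v.1.val (φ.toRingHom a) ≤ v.1.val (φ.toRingHom b)) := by
  have h1 : ∀ x, 1 ≤ (Spa.comap φ v.1).val x ↔ 1 ≤ v.1.val (φ.toRingHom x) := fun x => by
    rw [← map_one (Spa.comap φ v.1).val, Spa.comap_le_iff, map_one, map_one]
  rw [show (birMap φ v).1 = (Spa.comap φ v.1).retract from rfl, Spa.retract_le_iff,
    Spa.comap_le_iff]
  simp only [h1]

lemma one_le_birMap_iff (φ : P ⟶ Q) (v : Val Q) (b : P.B) :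
    1 ≤ (birMap φ v).1.val b ↔ 1 ≤ v.1.val (φ.toRingHom b) := by
  rw [← map_one (birMap φ v).1.val, birMap_le_iff, map_one, map_one]
  exact ⟨fun h => h ⟨1, by simp⟩, fun h _ => h⟩

lemma birMap_ne_zero_iff (φ : P ⟶ Q) (v : Val Q) (b : P.B) :
    (birMap φ v).1.val b ≠ 0 ↔ ∃ c, 1 ≤ v.1.val (φ.toRingHom (b * c)) := by
  refine ⟨fun h => ?_, ?_⟩
  · obtain ⟨c, hc⟩ := (Spa.not_bounded_iff _).1 (birMap φ v).2 b h
    exact ⟨c, (one_le_birMap_iff φ v _).1 hc⟩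
  · rintro ⟨c, hc⟩ h0
    rw [← one_le_birMap_iff, map_mul, h0, zero_mul] at hc
    exact absurd hc (not_le.2 zero_lt_one)

lemma birMap_id (v : Val P) : birMap (𝟙 P) v = v := by
  apply Subtype.ext
  have : Spa.comap (𝟙 P) v.1 = v.1 := Spa.ext_val fun a b => Spa.comap_le_iff _ _ _ _
  show (Spa.comap (𝟙 P) v.1).retract = v.1
  rw [this, Spa.retract_eq_self v.2]

lemma birMap_comp (φ : P ⟶ Q) (ψ : Q ⟶ R) (v : Val R) :
    birMap (φ ≫ ψ) v = birMap φ (birMap ψ v) := by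
  apply Subtype.ext
  apply Spa.ext_val
  intro a b
  have hc : ∀ x, (φ ≫ ψ).toRingHom x = ψ.toRingHom (φ.toRingHom x) := fun _ => rfl
  rw [birMap_le_iff, birMap_le_iff, birMap_le_iff]
  simp only [one_le_birMap_iff, hc]
  refine ⟨fun h h1 _ => h h1, fun h h1 => h h1 ?_⟩
  obtain ⟨c, hc⟩ := h1
  exact ⟨φ.toRingHom c, by simpa using hc⟩

/-- If `w = φ_bir v` then `φ` maps the complement of `ker w` into the complement of `ker v`. -/
lemma birMap_primeCompl {φ : P ⟶ Q} {v : Val Q} {w : Val P} (h : birMap φ v = w) :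
    w.1.ker.primeCompl ≤ Submonoid.comap φ.toRingHom v.1.ker.primeCompl := by
  subst h
  intro b hb
  have hb : (birMap φ v).1.val b ≠ 0 := fun h => hb (Spa.mem_ker.2 h)
  obtain ⟨c, hc⟩ := (birMap_ne_zero_iff φ v b).1 hb
  show φ.toRingHom b ∉ v.1.ker
  intro h0
  rw [Spa.mem_ker] at h0
  rw [map_mul, map_mul, h0, zero_mul] at hc
  exact absurd hc (not_le.2 zero_lt_one)

end Val

open AlgebraicGeometry

/-- A pair-ringed space `(X, M, O)`: a topological space with a sheaf of pairs of rings, i.e. a sheaf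
of rings `M` and a subsheaf of rings `O`. -/
structure PairRingedSpace : Type (u + 1) where
  /-- the ringed space `(X, M)` -/
  toM : RingedSpace.{u}
  /-- the subring `O(U)` of `M(U)` -/
  O : ∀ U : Opens toM, Subring (toM.presheaf.obj (op U))
  O_res : ∀ {U V : Opens toM} (i : V ⟶ U) (s : toM.presheaf.obj (op U)), s ∈ O U →
    toM.presheaf.map i.op s ∈ O V
  O_local : ∀ (U : Opens toM) (s : toM.presheaf.obj (op U)),
    (∀ x ∈ U, ∃ (V : Opens toM) (i : V ⟶ U), x ∈ V ∧ toM.presheaf.map i.op s ∈ O V) → s ∈ O U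

namespace PairRingedSpace

/-- The presheaf `O`. -/
def presheafO (X : PairRingedSpace.{u}) : X.toM.carrier.Presheaf CommRingCat.{u} where
  obj U := CommRingCat.of (X.O U.unop)
  map {U V} i := CommRingCat.ofHom
    ((X.toM.presheaf.map i).hom.restrict (X.O U.unop) (X.O V.unop)
      fun s hs => X.O_res i.unop s hs)
  map_id U := by
    ext s
    exact ConcreteCategory.congr_hom (X.toM.presheaf.map_id U) s.1
  map_comp i j := by
    ext s
    exact ConcreteCategory.congr_hom (X.toM.presheaf.map_comp i j) s.1

lemma isSheaf_presheafO (X : PairRingedSpace.{u}) : X.presheafO.IsSheaf := by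
  rw [TopCat.Presheaf.isSheaf_iff_isSheafUniqueGluing]
  intro ι U sf hsf
  have hc : TopCat.Presheaf.IsCompatible X.toM.presheaf U (fun i => (sf i).1) := fun i j =>
    congrArg Subtype.val (hsf i j)
  obtain ⟨s, hs, hu⟩ := X.toM.IsSheaf.isSheafUniqueGluing U (fun i => (sf i).1) hc
  refine ⟨⟨s, X.O_local _ _ fun x hx => ?_⟩, fun i => Subtype.ext (hs i), fun t ht =>
    Subtype.ext (hu t.1 fun i => congrArg Subtype.val (ht i))⟩
  obtain ⟨i, hi⟩ := Opens.mem_iSup.1 hx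
  refine ⟨U i, Opens.leSupr U i, hi, ?_⟩
  have := hs i
  dsimp only at this
  rw [this]
  exact (sf i).2

/-- The ringed space `(X, O)`. -/
def toO (X : PairRingedSpace.{u}) : RingedSpace.{u} where
  carrier := X.toM.carrier
  presheaf := X.presheafO
  IsSheaf := X.isSheaf_presheafO

/-- A morphism of pair-ringed spaces: a morphism `(X, M_X) → (Y, M_Y)` of ringed spaces mapping `O_Y`
into `O_X`. -/
@[ext]
structure Hom (X Y : PairRingedSpace.{u}) : Type u where
  hom : X.toM ⟶ Y.toM
  map_O : ∀ (U : Opens Y.toM) (s : Y.toM.presheaf.obj (op U)), s ∈ Y.O U →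
    hom.hom.c.app (op U) s ∈ X.O ((Opens.map hom.hom.base).obj U)

instance : Category.{u} PairRingedSpace.{u} where
  Hom X Y := Hom X Y
  id X := ⟨𝟙 X.toM, fun _ _ hs => hs⟩
  comp f g := ⟨f.hom ≫ g.hom, fun U s hs => f.map_O _ _ (g.map_O U s hs)⟩

/-- The morphism `(X, O_X) → (Y, O_Y)` of ringed spaces underlying a morphism of pair-ringed
spaces. -/
def Hom.toO {X Y : PairRingedSpace.{u}} (f : Hom X Y) : X.toO ⟶ Y.toO :=
  InducedCategory.homMk
    { base := f.hom.hom.base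
      c :=
        { app := fun U => CommRingCat.ofHom
            ((f.hom.hom.c.app U).hom.restrict (Y.O U.unop)
              (X.O ((Opens.map f.hom.hom.base).obj U.unop)) fun s hs => f.map_O U.unop s hs)
          naturality := fun U V i => by
            ext s
            apply Subtype.ext
            exact ConcreteCategory.congr_hom (f.hom.hom.c.naturality i) s.1 } }

/-- The maps on stalks of `O` are local: the condition that `(X, O_X) → (Y, O_Y)` be a map of
locally ringed spaces. -/
def Hom.IsLocal {X Y : PairRingedSpace.{u}} (f : Hom X Y) : Prop :=
  ∀ x : X.toO, IsLocalHom (f.toO.hom.stalkMap x).hom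

lemma isLocal_id (X : PairRingedSpace.{u}) : Hom.IsLocal (𝟙 X) := fun x => by
  have h : (Hom.toO (𝟙 X)).hom.stalkMap x = 𝟙 _ := PresheafedSpace.stalkMap.id X.toO.toPresheafedSpace x
  rw [h]
  exact isLocalHom_id _

lemma isLocal_comp {X Y Z : PairRingedSpace.{u}} (f : X ⟶ Y) (g : Y ⟶ Z)
    (hf : Hom.IsLocal f) (hg : Hom.IsLocal g) : Hom.IsLocal (f ≫ g) := fun x => by
  have h : (Hom.toO (f ≫ g)).hom.stalkMap x =
      (Hom.toO g).hom.stalkMap ((Hom.toO f).hom.base x) ≫ (Hom.toO f).hom.stalkMap x :=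
    PresheafedSpace.stalkMap.comp (Hom.toO f).hom (Hom.toO g).hom x
  rw [h]
  refine ⟨fun a ha => ?_⟩
  exact (hg ((Hom.toO f).hom.base x)).map_nonunit a ((hf x).map_nonunit _ ha)

end PairRingedSpace

/-- The data of a rational domain: `b, a₁, …, aₙ ∈ B` generating the unit ideal
(`T` is the set of the `aᵢ`). -/
structure RatDatum (P : PaRing.{u}) : Type u where
  b : P.B
  T : Set P.B
  finite : T.Finite
  span_eq_top : Ideal.span (insert b T) = ⊤

namespace RatDatum

variable {P Q : PaRing.{u}}

/-- The rational domain `{v ∈ Val(B, A) | v aᵢ ≤ v b for all i}`. -/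
def dom (D : RatDatum P) : Set (Val P) := {v | ∀ a ∈ D.T, v.1.val a ≤ v.1.val D.b}

/-- The pair `(B_b, φ_b(A)[a₁/b, …, aₙ/b])`. -/
def pair (D : RatDatum P) : PaRing.{u} :=
  ⟨Localization.Away D.b, Subring.closure
    (algebraMap P.B (Localization.Away D.b) '' P.A ∪
      (fun a => IsLocalization.mk' (Localization.Away D.b) a
        (⟨D.b, Submonoid.mem_powers D.b⟩ : Submonoid.powers D.b)) '' D.T)⟩

instance (D : RatDatum P) : Algebra P.B D.pair.B := inferInstanceAs (Algebra P.B (Localization.Away D.b))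

instance (D : RatDatum P) : IsLocalization.Away D.b D.pair.B :=
  inferInstanceAs (IsLocalization.Away D.b (Localization.Away D.b))

lemma val_b_ne_zero {D : RatDatum P} {v : Val P} (h : v ∈ D.dom) : v.1.val D.b ≠ 0 := by
  intro h0
  have : Ideal.span (insert D.b D.T) ≤ v.1.ker := by
    rw [Ideal.span_le]
    rintro a (rfl | ha)
    · exact Spa.mem_ker.2 h0
    · exact Spa.mem_ker.2 (le_zero_iff.1 ((h a ha).trans h0.le))
  rw [D.span_eq_top] at this
  exact Ideal.IsPrime.ne_top inferInstance (top_le_iff.1 this)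

lemma isOpen_dom (D : RatDatum P) : IsOpen D.dom := by
  have hU : ∀ a b : P.B, IsOpen {v : Val P | v.1.val a ≤ v.1.val b ∧ v.1.val b ≠ 0} := fun a b =>
    (TopologicalSpace.isOpen_generateFrom_of_mem ⟨a, b, rfl⟩ :
      IsOpen {v : Spa P | v.val a ≤ v.val b ∧ v.val b ≠ 0}).preimage continuous_subtype_val
  have : D.dom = ⋂ a ∈ insert D.b D.T,
      {v : Val P | v.1.val a ≤ v.1.val D.b ∧ v.1.val D.b ≠ 0} := by
    ext v
    simp only [Set.mem_iInter]
    constructor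
    · rintro h a (rfl | ha)
      · exact ⟨le_rfl, val_b_ne_zero h⟩
      · exact ⟨h a ha, val_b_ne_zero h⟩
    · exact fun h a ha => (h a (Or.inr ha)).1
  rw [this]
  exact (D.finite.insert D.b).isOpen_biInter fun a _ => hU a D.b

/-- The canonical map `B_b → B_𝔭`, where `𝔭` is the kernel of a point `v` of the rational domain. -/
def germ (D : RatDatum P) (v : Val P) (h : v ∈ D.dom) :
    D.pair.B →+* Localization.AtPrime v.1.ker :=
  IsLocalization.Away.lift (S := D.pair.B) D.b
    (g := algebraMap P.B (Localization.AtPrime v.1.ker))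
    (IsLocalization.map_units (Localization.AtPrime v.1.ker)
      (⟨D.b, fun h0 => val_b_ne_zero h (Spa.mem_ker.1 h0)⟩ : v.1.ker.primeCompl))

lemma germ_algebraMap (D : RatDatum P) (v : Val P) (h : v ∈ D.dom) (x : P.B) :
    D.germ v h (algebraMap P.B D.pair.B x) = algebraMap P.B (Localization.AtPrime v.1.ker) x :=
  IsLocalization.Away.lift_eq _ _ x

/-- The rational domain datum of the intersection of two rational domains. -/
def mul (D E : RatDatum P) : RatDatum P where
  b := D.b * E.b
  T := Set.image2 (· * ·) (insert D.b D.T) (insert E.b E.T)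
  finite := Set.Finite.image2 _ (D.finite.insert _) (E.finite.insert _)
  span_eq_top := by
    rw [Set.insert_eq_of_mem (Set.mem_image2_of_mem (Set.mem_insert _ _) (Set.mem_insert _ _))]
    have := Ideal.span_mul_span' (insert D.b D.T) (insert E.b E.T)
    rw [D.span_eq_top, E.span_eq_top, Ideal.top_mul] at this
    exact this.symm

lemma mem_dom_mul {D E : RatDatum P} {v : Val P} (h : v ∈ D.dom) (h' : v ∈ E.dom) :
    v ∈ (D.mul E).dom := by
  rintro _ ⟨a, ha, c, hc, rfl⟩
  show v.1.val (a * c) ≤ v.1.val (D.b * E.b)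
  rw [map_mul, map_mul]
  refine mul_le_mul' ?_ ?_
  · rcases ha with rfl | ha
    · exact le_rfl
    · exact h a ha
  · rcases hc with rfl | hc
    · exact le_rfl
    · exact h' c hc

lemma isUnit_map (φ : P ⟶ Q) (D : RatDatum P) (E : RatDatum Q) (c : Q.B)
    (hb : E.b = φ.toRingHom D.b * c) :
    IsUnit ((algebraMap Q.B E.pair.B).comp φ.toRingHom D.b) := by
  have h : IsUnit (algebraMap Q.B E.pair.B E.b) := IsLocalization.Away.algebraMap_isUnit E.b
  rw [hb, map_mul] at h
  exact isUnit_of_mul_isUnit_left h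

/-- The homomorphism `(B_b, φ_b(A)[aᵢ/b]) → (B'_{b'}, φ_{b'}(A')[a'ⱼ/b'])` induced by a homomorphism
of pairs `φ` if `b' = φ b * c` and each `φ aᵢ * c` is `b'` or some `a'ⱼ`. -/
def map (φ : P ⟶ Q) (D : RatDatum P) (E : RatDatum Q) (c : Q.B) (hb : E.b = φ.toRingHom D.b * c)
    (hT : ∀ a ∈ D.T, φ.toRingHom a * c ∈ insert E.b E.T) : D.pair ⟶ E.pair where
  toRingHom := IsLocalization.Away.lift (S := D.pair.B) D.b
    (g := (algebraMap Q.B E.pair.B).comp φ.toRingHom) (isUnit_map φ D E c hb)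
  map_mem := by
    intro x hx
    set f : D.pair.B →+* E.pair.B := IsLocalization.Away.lift (S := D.pair.B) D.b
      (isUnit_map φ D E c hb) with hf
    have hfa : ∀ y, f (algebraMap P.B D.pair.B y) = algebraMap Q.B E.pair.B (φ.toRingHom y) :=
      fun y => IsLocalization.Away.lift_eq _ _ y
    have hu : IsUnit (algebraMap Q.B E.pair.B E.b) := IsLocalization.Away.algebraMap_isUnit E.b
    refine (Subring.closure_le (t := E.pair.A.comap f)).2 ?_ hx
    rintro _ (⟨a, ha, rfl⟩ | ⟨a, ha, rfl⟩)
    · refine Subring.subset_closure (Or.inl ⟨φ.toRingHom a, φ.map_mem a ha, ?_⟩)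
      exact (hfa a).symm
    · have key : f (IsLocalization.mk' D.pair.B a
          (⟨D.b, Submonoid.mem_powers D.b⟩ : Submonoid.powers D.b)) * algebraMap Q.B E.pair.B E.b
          = algebraMap Q.B E.pair.B (φ.toRingHom a * c) := by
        rw [hb, map_mul, ← mul_assoc, ← hfa, ← map_mul]
        have : IsLocalization.mk' D.pair.B a
          (⟨D.b, Submonoid.mem_powers D.b⟩ : Submonoid.powers D.b) * algebraMap P.B D.pair.B D.b
          = algebraMap P.B D.pair.B a := IsLocalization.mk'_spec _ a _
        rw [this, hfa, map_mul]
      show f (IsLocalization.mk' D.pair.B a _) ∈ E.pair.A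
      rcases hT a ha with h | h
      · rw [h] at key
        have h1 := hu.mul_right_cancel (key.trans (one_mul _).symm)
        rw [h1]
        exact E.pair.A.one_mem
      · refine Subring.subset_closure (Or.inr ⟨_, h, ?_⟩)
        apply hu.mul_right_cancel
        exact Eq.trans (IsLocalization.mk'_spec (Localization.Away E.b) (φ.toRingHom a * c)
          (⟨E.b, Submonoid.mem_powers E.b⟩ : Submonoid.powers E.b)) key.symm

lemma map_algebraMap (φ : P ⟶ Q) (D : RatDatum P) (E : RatDatum Q) (c : Q.B) (hb) (hT) (y : P.B) :
    (map φ D E c hb hT).toRingHom (algebraMap P.B D.pair.B y) =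
      algebraMap Q.B E.pair.B (φ.toRingHom y) :=
  IsLocalization.Away.lift_eq D.b (isUnit_map φ D E c hb) y

end RatDatum

namespace Val

variable {P Q R : PaRing.{u}}

/-- The map `B_𝔮 → B'_𝔭` on localizations at the kernels of `v` and `w = φ_bir v`. -/
def stalkHom (φ : P ⟶ Q) (v : Val Q) (w : Val P) (h : birMap φ v = w) :
    Localization.AtPrime w.1.ker →+* Localization.AtPrime v.1.ker :=
  IsLocalization.map (Localization.AtPrime v.1.ker) φ.toRingHom (birMap_primeCompl h)

lemma stalkHom_algebraMap (φ : P ⟶ Q) (v : Val Q) (w : Val P) (h : birMap φ v = w) (x : P.B) :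
    stalkHom φ v w h (algebraMap P.B _ x) = algebraMap Q.B _ (φ.toRingHom x) :=
  IsLocalization.map_eq _ x

lemma stalkHom_id (v w : Val P) (h : birMap (𝟙 P) v = w)
    (hw : v = w) (x : Localization.AtPrime w.1.ker) :
    stalkHom (𝟙 P) v w h x = hw ▸ x := by
  subst hw
  have : stalkHom (𝟙 P) v v h = RingHom.id _ := by
    apply IsLocalization.ringHom_ext v.1.ker.primeCompl
    ext y
    exact stalkHom_algebraMap _ _ _ h y
  rw [this]; rfl

lemma stalkHom_comp (φ : P ⟶ Q) (ψ : Q ⟶ R) (v : Val R) (w : Val Q) (u : Val P)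
    (h : birMap ψ v = w) (h' : birMap φ w = u) (h'' : birMap (φ ≫ ψ) v = u)
    (x : Localization.AtPrime u.1.ker) :
    stalkHom (φ ≫ ψ) v u h'' x = stalkHom ψ v w h (stalkHom φ w u h' x) := by
  have : stalkHom (φ ≫ ψ) v u h'' = (stalkHom ψ v w h).comp (stalkHom φ w u h') := by
    apply IsLocalization.ringHom_ext u.1.ker.primeCompl
    ext y
    simp only [RingHom.comp_apply, stalkHom_algebraMap]
    rfl
  rw [this]; rfl

lemma stalkHom_germ (φ : P ⟶ Q) (D : RatDatum P) (E : RatDatum Q) (c : Q.B) (hb) (hT)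
    (v : Val Q) (hv : v ∈ E.dom) (w : Val P) (h : birMap φ v = w) (hw : w ∈ D.dom) (x : D.pair.B) :
    stalkHom φ v w h (D.germ w hw x) = E.germ v hv ((RatDatum.map φ D E c hb hT).toRingHom x) := by
  have : (stalkHom φ v w h).comp (D.germ w hw) =
      (E.germ v hv).comp (RatDatum.map φ D E c hb hT).toRingHom := by
    apply IsLocalization.ringHom_ext (Submonoid.powers D.b)
    ext y
    simp only [RingHom.comp_apply, RatDatum.germ_algebraMap, stalkHom_algebraMap,
      RatDatum.map_algebraMap]
  exact congrArg (fun f => f x) this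

lemma germ_map (D E : RatDatum P) (c : P.B) (hb) (hT) (v : Val P) (hv : v ∈ E.dom)
    (hw : v ∈ D.dom) (x : D.pair.B) :
    E.germ v hv ((RatDatum.map (𝟙 P) D E c hb hT).toRingHom x) = D.germ v hw x := by
  rw [← stalkHom_germ (𝟙 P) D E c hb hT v hv v (birMap_id v) hw x, stalkHom_id _ _ _ rfl]

/-- The sections over `U` of the sheaf on `Val(B, A)` generated by the presheaf
`X({aᵢ}/b) ↦ N({aᵢ}/b) ⊆ B_b` on rational domains: functions with values in the local rings `B_𝔭`
(`𝔭` the kernel of the point) which locally come from elements of `N({aᵢ}/b)`. This is the usual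
description of the associated sheaf by functions with values in the stalks. -/
def IsSection (N : ∀ D : RatDatum P, Subring D.pair.B) (U : Opens (Val P))
    (s : ∀ v : U, Localization.AtPrime v.1.1.ker) : Prop :=
  ∀ v ∈ U, ∃ V : Opens (Val P), v ∈ V ∧ ∃ (hVU : V ≤ U) (D : RatDatum P)
    (hD : ∀ w ∈ V, w ∈ D.dom), ∃ x ∈ N D,
      ∀ w (hw : w ∈ V), s ⟨w, hVU hw⟩ = D.germ w (hD w hw) x

/-- The ring of sections as in `IsSection`. -/
def sectionRing (N : ∀ D : RatDatum P, Subring D.pair.B)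
    (hN : ∀ (D E : RatDatum P) (f : D.pair ⟶ E.pair), ∀ x ∈ N D, f.toRingHom x ∈ N E)
    (U : Opens (Val P)) : Subring (∀ v : U, Localization.AtPrime v.1.1.ker) := by
  have key : ∀ (s t u : ∀ v : U, Localization.AtPrime v.1.1.ker),
      IsSection N U s → IsSection N U t →
      (∀ v ∈ U, ∀ D : RatDatum P, ∀ x ∈ N D, ∀ y ∈ N D, ∃ z ∈ N D, ∀ w (hw : w ∈ U) (hD : w ∈ D.dom),
        s ⟨w, hw⟩ = D.germ w hD x → t ⟨w, hw⟩ = D.germ w hD y → u ⟨w, hw⟩ = D.germ w hD z) →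
      IsSection N U u := by
    intro s t u hs ht H v hv
    obtain ⟨V, hvV, hVU, D, hD, x, hx, hsx⟩ := hs v hv
    obtain ⟨W, hvW, hWU, E, hE, y, hy, hty⟩ := ht v hv
    let f : D.pair ⟶ (D.mul E).pair := RatDatum.map (𝟙 P) D (D.mul E) E.b rfl fun a ha =>
      Or.inr ⟨a, Or.inr ha, E.b, Or.inl rfl, rfl⟩
    let g : E.pair ⟶ (D.mul E).pair := RatDatum.map (𝟙 P) E (D.mul E) D.b (mul_comm _ _)
      fun a ha => Or.inr ⟨D.b, Or.inl rfl, a, Or.inr ha, mul_comm _ _⟩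
    obtain ⟨z, hz, h⟩ := H v hv (D.mul E) _ (hN _ _ f x hx) _ (hN _ _ g y hy)
    refine ⟨V ⊓ W, ⟨hvV, hvW⟩, inf_le_left.trans hVU, D.mul E,
      fun w hw => RatDatum.mem_dom_mul (hD w hw.1) (hE w hw.2), z, hz, fun w hw => ?_⟩
    refine h w _ _ ?_ ?_
    · rw [hsx w hw.1]
      exact (germ_map D (D.mul E) E.b _ _ w _ (hD w hw.1) x).symm
    · rw [hty w hw.2]
      exact (germ_map E (D.mul E) D.b _ _ w _ (hE w hw.2) y).symm
  have one : IsSection N U 1 := fun v hv =>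
    ⟨U, hv, le_rfl, ⟨1, ∅, Set.finite_empty, by simp⟩, fun w _ a ha => absurd ha (Set.notMem_empty a),
      1, Subring.one_mem _, fun w _ => by simp⟩
  have neg : ∀ s, IsSection N U s → IsSection N U (-s) := fun s hs =>
    key s s _ hs hs fun v hv D x hx y hy => ⟨-x, neg_mem hx, fun w hw hD h1 h2 => by
      rw [map_neg, ← h1]; rfl⟩
  have add : ∀ s t, IsSection N U s → IsSection N U t → IsSection N U (s + t) := fun s t hs ht =>
    key s t _ hs ht fun v hv D x hx y hy => ⟨x + y, add_mem hx hy, fun w hw hD h1 h2 => by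
      rw [map_add, ← h1, ← h2]; rfl⟩
  exact
    { carrier := {s | IsSection N U s}
      one_mem' := one
      mul_mem' := fun {s t} hs ht =>
        key s t _ hs ht fun v hv D x hx y hy => ⟨x * y, mul_mem hx hy, fun w hw hD h1 h2 => by
          rw [map_mul, ← h1, ← h2]; rfl⟩
      add_mem' := fun {s t} hs ht => add s t hs ht
      neg_mem' := fun {s} hs => neg s hs
      zero_mem' := by
        have := add 1 (-1) one (neg 1 one)
        rwa [add_neg_cancel] at this }

lemma IsSection.res {N : ∀ D : RatDatum P, Subring D.pair.B} {U V : Opens (Val P)} (i : V ≤ U)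
    {s : ∀ v : U, Localization.AtPrime v.1.1.ker} (hs : IsSection N U s) :
    IsSection N V fun v => s ⟨v.1, i v.2⟩ := by
  intro v hv
  obtain ⟨W, hvW, hWU, D, hD, x, hx, h⟩ := hs v (i hv)
  exact ⟨W ⊓ V, ⟨hvW, hv⟩, inf_le_right, D, fun w hw => hD w hw.1, x, hx, fun w hw => h w hw.1⟩

lemma IsSection.of_local {N : ∀ D : RatDatum P, Subring D.pair.B} {U : Opens (Val P)}
    {s : ∀ v : U, Localization.AtPrime v.1.1.ker}
    (hs : ∀ v ∈ U, ∃ (V : Opens (Val P)) (i : V ≤ U), v ∈ V ∧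
      IsSection N V fun v => s ⟨v.1, i v.2⟩) : IsSection N U s := by
  intro v hv
  obtain ⟨V, i, hvV, h⟩ := hs v hv
  obtain ⟨W, hvW, hWV, D, hD, x, hx, h'⟩ := h v hvV
  exact ⟨W, hvW, hWV.trans i, D, hD, x, hx, h'⟩

/-- Sections of `M` over `U`: the presheaf on rational domains is `X({aᵢ}/b) ↦ B_b`. -/
def sectionsM (P : PaRing.{u}) (U : Opens (Val P)) :
    Subring (∀ v : U, Localization.AtPrime v.1.1.ker) :=
  sectionRing (fun _ => ⊤) (fun _ _ _ _ _ => trivial) U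

/-- Sections of `O` over `U`: the presheaf on rational domains is
`X({aᵢ}/b) ↦ Nor_{B_b} (φ_b(A)[a₁/b, …, aₙ/b])`. -/
def sectionsO (P : PaRing.{u}) (U : Opens (Val P)) :
    Subring (∀ v : U, Localization.AtPrime v.1.1.ker) :=
  sectionRing (fun D => D.pair.nor.A) (fun _ _ f _ hx => f.map_nor hx) U

lemma sectionsO_le (P : PaRing.{u}) (U : Opens (Val P)) : sectionsO P U ≤ sectionsM P U := by
  intro s hs v hv
  obtain ⟨V, hvV, hVU, D, hD, x, hx, h⟩ := hs v hv
  exact ⟨V, hvV, hVU, D, hD, x, trivial, h⟩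

/-- The presheaf `M` on `Val(B, A)`. -/
def presheafM (P : PaRing.{u}) : (TopCat.of (Val P)).Presheaf CommRingCat.{u} where
  obj U := CommRingCat.of (sectionsM P U.unop)
  map {U V} i := CommRingCat.ofHom
    { toFun := fun s => ⟨fun v => s.1 ⟨v.1, i.unop.le v.2⟩, IsSection.res i.unop.le s.2⟩
      map_one' := rfl
      map_mul' := fun _ _ => rfl
      map_zero' := rfl
      map_add' := fun _ _ => rfl }

lemma isSheaf_presheafM (P : PaRing.{u}) : (presheafM P).IsSheaf := by
  rw [TopCat.Presheaf.isSheaf_iff_isSheafUniqueGluing]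
  intro ι U sf hsf
  have hU : ∀ v : (iSup U : Opens (Val P)), ∃ i, v.1 ∈ U i := fun v => Opens.mem_iSup.1 v.2
  choose k hk using hU
  have hc : ∀ i j v (hi : v ∈ U i) (hj : v ∈ U j), (sf i).1 ⟨v, hi⟩ = (sf j).1 ⟨v, hj⟩ :=
    fun i j v hi hj => congrFun (congrArg Subtype.val (hsf i j)) ⟨v, hi, hj⟩
  have hS : IsSection (fun _ => ⊤) (iSup U : Opens (Val P))
      fun v => (sf (k v)).1 ⟨v.1, hk v⟩ := by
    refine IsSection.of_local fun v hv => ?_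
    refine ⟨U (k ⟨v, hv⟩), le_iSup U _, hk ⟨v, hv⟩, ?_⟩
    have := (sf (k ⟨v, hv⟩)).2
    convert (show IsSection (fun _ => ⊤) _ _ from this) using 2
    exact hc _ _ _ _ _
  refine ⟨⟨fun v => (sf (k v)).1 ⟨v.1, hk v⟩, hS⟩, fun i => ?_, fun t ht => ?_⟩
  · apply Subtype.ext
    funext v
    exact hc _ _ _ _ _
  · apply Subtype.ext
    funext v
    exact congrFun (congrArg Subtype.val (ht (k v))) ⟨v.1, hk v⟩

/-- The pair-ringed space `(Val(B, A), M, O)`. -/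
def space (P : PaRing.{u}) : PairRingedSpace.{u} where
  toM :=
    { carrier := TopCat.of (Val P)
      presheaf := presheafM P
      IsSheaf := isSheaf_presheafM P }
  O U := (sectionsO P U).comap (sectionsM P U).subtype
  O_res i _ hs := IsSection.res i.le hs
  O_local _ _ h := IsSection.of_local fun v hv => by
    obtain ⟨V, i, hvV, h'⟩ := h v hv
    exact ⟨V, i.le, hvV, h'⟩

end Val

namespace Val

variable {P Q R : PaRing.{u}}

/-- The image of a rational domain datum under a homomorphism of pairs. -/
def _root_.Birational.RatDatum.push (φ : P ⟶ Q) (D : RatDatum P) : RatDatum Q where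
  b := φ.toRingHom D.b
  T := φ.toRingHom '' D.T
  finite := D.finite.image _
  span_eq_top := by
    rw [← Set.image_insert_eq, ← Ideal.map_span, D.span_eq_top, Ideal.map_top]

lemma mem_push_dom {φ : P ⟶ Q} {D : RatDatum P} {v : Val Q} (h : birMap φ v ∈ D.dom) :
    v ∈ (D.push φ).dom := by
  rintro _ ⟨a, ha, rfl⟩
  show v.1.val (φ.toRingHom a) ≤ v.1.val (φ.toRingHom D.b)
  obtain ⟨c, hc⟩ := (birMap_ne_zero_iff φ v D.b).1 (RatDatum.val_b_ne_zero h)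
  by_contra! hlt
  refine absurd ((birMap_le_iff φ v a D.b).1 (h a ha) ⟨c, ?_⟩) (not_le.2 hlt)
  refine hc.trans ?_
  rw [map_mul, map_mul, map_mul, map_mul]
  gcongr

/-- Pull back of a family of elements of the local rings along `φ_bir`. -/
def pull (φ : P ⟶ Q) {U : Opens (Val P)} {V : Opens (Val Q)} (hV : ∀ v ∈ V, birMap φ v ∈ U)
    (s : ∀ w : U, Localization.AtPrime w.1.1.ker) (v : V) : Localization.AtPrime v.1.1.ker :=
  stalkHom φ v.1 (birMap φ v.1) rfl (s ⟨birMap φ v.1, hV v.1 v.2⟩)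

lemma IsSection.pull (φ : P ⟶ Q) {N : ∀ D : RatDatum P, Subring D.pair.B}
    {N' : ∀ D : RatDatum Q, Subring D.pair.B}
    (hN : ∀ (D : RatDatum P) (E : RatDatum Q) (f : D.pair ⟶ E.pair), ∀ x ∈ N D, f.toRingHom x ∈ N' E)
    {U : Opens (Val P)} {V : Opens (Val Q)} (hV : ∀ v ∈ V, birMap φ v ∈ U)
    {s : ∀ w : U, Localization.AtPrime w.1.1.ker} (hs : IsSection N U s) :
    IsSection N' V (Val.pull φ hV s) := by
  intro v hv
  obtain ⟨W, hvW, hWU, D, hD, x, hx, h⟩ := hs _ (hV v hv)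
  let f : D.pair ⟶ (D.push φ).pair := RatDatum.map φ D (D.push φ) 1 (mul_one _).symm
    fun a ha => Or.inr ⟨a, ha, (mul_one _).symm⟩
  refine ⟨⟨birMap φ ⁻¹' W, W.2.preimage (continuous_birMap φ)⟩ ⊓ V, ⟨hvW, hv⟩, inf_le_right,
    D.push φ, fun w hw => mem_push_dom (hD _ hw.1), f.toRingHom x, hN _ _ f x hx, fun w hw => ?_⟩
  show stalkHom φ w (birMap φ w) rfl (s ⟨birMap φ w, _⟩) = _
  rw [h _ hw.1]
  exact stalkHom_germ φ D (D.push φ) 1 _ _ w _ _ rfl (hD _ hw.1) x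

/-- The morphism of pair-ringed spaces `φ_bir : Val(B', A') → Val(B, A)`: it is `r ∘ φ^*` on points
and is induced by `φ` on sections. -/
def birHom (φ : P ⟶ Q) : space Q ⟶ space P where
  hom := InducedCategory.homMk
    { base := TopCat.ofHom ⟨birMap φ, continuous_birMap φ⟩
      c :=
        { app := fun _ => CommRingCat.ofHom
            { toFun := fun s => ⟨pull φ (fun _ hv => hv) s.1,
                IsSection.pull φ (N' := fun _ => ⊤) (fun _ _ _ _ _ => trivial) _ s.2⟩
              map_one' := Subtype.ext (funext fun v => map_one (stalkHom φ v.1 _ rfl))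
              map_mul' := fun s t => Subtype.ext (funext fun v =>
                map_mul (stalkHom φ v.1 _ rfl) (s.1 ⟨_, v.2⟩) (t.1 ⟨_, v.2⟩))
              map_zero' := Subtype.ext (funext fun v => map_zero (stalkHom φ v.1 _ rfl))
              map_add' := fun s t => Subtype.ext (funext fun v =>
                map_add (stalkHom φ v.1 _ rfl) (s.1 ⟨_, v.2⟩) (t.1 ⟨_, v.2⟩)) }
          naturality := fun _ _ _ => rfl } }
  map_O _ _ hs := IsSection.pull φ (fun _ _ f _ hx => f.map_nor hx) (fun _ hv => hv) hs

lemma hom_ext {α β : space Q ⟶ space P}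
    (h : ∀ v : Val Q, α.hom.hom.base v = β.hom.hom.base v)
    (h' : ∀ (U : Opens (Val P)) (s : sectionsM P U) (v : Val Q) (hv : α.hom.hom.base v ∈ U)
      (hv' : β.hom.hom.base v ∈ U),
      ((α.hom.hom.c.app (op U)).hom s : sectionsM Q _).1 ⟨v, hv⟩ =
        ((β.hom.hom.c.app (op U)).hom s : sectionsM Q _).1 ⟨v, hv'⟩) : α = β := by
  apply PairRingedSpace.Hom.ext
  refine SheafedSpace.ext _ _ (TopCat.hom_ext (ContinuousMap.ext h)) ?_
  apply NatTrans.ext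
  funext U
  apply CommRingCat.hom_ext
  ext s
  refine Subtype.ext (funext fun v => ?_)
  exact h' U.unop s v.1 _ v.2

lemma stalkHom_id_section {U : Opens (Val P)} (s : ∀ w : U, Localization.AtPrime w.1.1.ker)
    (v w : Val P) (h : birMap (𝟙 P) v = w) (hv : v ∈ U) (hw : w ∈ U) :
    stalkHom (𝟙 P) v w h (s ⟨w, hw⟩) = s ⟨v, hv⟩ := by
  obtain rfl : v = w := (birMap_id v).symm.trans h
  exact stalkHom_id v v h rfl _

lemma birHom_id : birHom (𝟙 P) = 𝟙 (space P) :=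
  hom_ext (fun v => birMap_id v) fun _ s v hv hv' => stalkHom_id_section s.1 v _ rfl hv' hv

lemma stalkHom_comp_section (φ : P ⟶ Q) (ψ : Q ⟶ R) {U : Opens (Val P)}
    (s : ∀ w : U, Localization.AtPrime w.1.1.ker)
    (v : Val R) (u : Val P) (h : birMap (φ ≫ ψ) v = u) (hu : u ∈ U)
    (hu' : birMap φ (birMap ψ v) ∈ U) :
    stalkHom (φ ≫ ψ) v u h (s ⟨u, hu⟩) =
      stalkHom ψ v _ rfl (stalkHom φ (birMap ψ v) _ rfl (s ⟨birMap φ (birMap ψ v), hu'⟩)) := by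
  obtain rfl : birMap φ (birMap ψ v) = u := (birMap_comp φ ψ v).symm.trans h
  exact stalkHom_comp φ ψ v _ _ rfl rfl h _

lemma birHom_comp (φ : P ⟶ Q) (ψ : Q ⟶ R) : birHom (φ ≫ ψ) = birHom ψ ≫ birHom φ :=
  hom_ext (fun v => birMap_comp φ ψ v) fun _ s v hv hv' =>
    stalkHom_comp_section φ ψ s.1 v _ rfl hv hv'

/-- The valuation on `B_𝔭` extending `v`, where `𝔭` is the kernel of `v`. -/
def stalkVal (v : Val P) : Valuation (Localization.AtPrime v.1.ker) v.1.Γ₀ :=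
  v.1.val.extendToLocalization (S := v.1.ker.primeCompl) le_rfl _

lemma stalkVal_algebraMap (v : Val P) (x : P.B) :
    stalkVal v (algebraMap P.B _ x) = v.1.val x :=
  Valuation.extendToLocalization_apply_map_apply _ _ _ _

lemma stalkVal_germ_le {D : RatDatum P} {v : Val P} (hv : v ∈ D.dom) {x : D.pair.B}
    (hx : x ∈ D.pair.nor.A) : stalkVal v (D.germ v hv x) ≤ 1 := by
  let ν := (stalkVal v).comap (D.germ v hv)
  have hν : ∀ y, ν (algebraMap P.B D.pair.B y) = v.1.val y := fun y => by
    show stalkVal v (D.germ v hv (algebraMap P.B D.pair.B y)) = _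
    rw [RatDatum.germ_algebraMap, stalkVal_algebraMap]
  have hA : D.pair.A ≤ ν.integer := by
    refine (Subring.closure_le (t := ν.integer)).2 ?_
    rintro _ (⟨a, ha, rfl⟩ | ⟨a, ha, rfl⟩)
    · show ν (algebraMap P.B D.pair.B a) ≤ 1
      rw [hν]
      exact v.1.val_le_one ha
    · show ν (IsLocalization.mk' D.pair.B a
        (⟨D.b, Submonoid.mem_powers D.b⟩ : Submonoid.powers D.b)) ≤ 1
      have h : IsLocalization.mk' D.pair.B a
          (⟨D.b, Submonoid.mem_powers D.b⟩ : Submonoid.powers D.b) * algebraMap P.B D.pair.B D.b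
          = algebraMap P.B D.pair.B a := IsLocalization.mk'_spec _ a _
      have h2 := congrArg ν h
      rw [map_mul, hν, hν] at h2
      refine le_of_mul_le_mul_right ?_ (zero_lt_iff.2 (RatDatum.val_b_ne_zero hv))
      rw [h2, one_mul]
      exact hv a ha
  have hi : IsIntegral ν.integer x := by
    obtain ⟨p, hp, h0⟩ := (PaRing.mem_nor.1 hx)
    refine ⟨p.map (Subring.inclusion hA), hp.map _, ?_⟩
    rw [Polynomial.eval₂_map]
    exact h0
  exact (Valuation.integer.integers ν).mem_of_integral hi

lemma stalkVal_section_le {U : Opens (Val P)} {s : ∀ v : U, Localization.AtPrime v.1.1.ker}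
    (hs : s ∈ sectionsO P U) (v : U) : stalkVal v.1 (s v) ≤ 1 := by
  obtain ⟨V, hvV, hVU, D, hD, x, hx, h⟩ := hs v.1 v.2
  rw [show s v = _ from h v.1 hvV]
  exact stalkVal_germ_le _ hx

lemma stalkVal_stalkHom_lt (φ : P ⟶ Q) (v : Val Q) (x : Localization.AtPrime (birMap φ v).1.ker)
    (hx : stalkVal _ x < 1) : stalkVal v (stalkHom φ v _ rfl x) < 1 := by
  obtain ⟨g, s, hgs⟩ := IsLocalization.exists_mk'_eq (birMap φ v).1.ker.primeCompl x
  have h : x * algebraMap P.B _ s.1 = algebraMap P.B _ g := by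
    rw [← hgs]; exact IsLocalization.mk'_spec _ _ _
  have hs0 : (birMap φ v).1.val s.1 ≠ 0 := fun h0 => s.2 (Spa.mem_ker.2 h0)
  have h1 := congrArg (stalkVal _) h
  rw [map_mul, stalkVal_algebraMap, stalkVal_algebraMap] at h1
  have h2 := congrArg (fun y => stalkVal v (stalkHom φ v _ rfl y)) h
  simp only [map_mul, stalkHom_algebraMap, stalkVal_algebraMap] at h2
  have hlt : ¬ (birMap φ v).1.val s.1 ≤ (birMap φ v).1.val g := by
    rw [← h1, not_le]
    exact mul_lt_of_lt_one_left (zero_lt_iff.2 hs0) hx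
  rw [birMap_le_iff] at hlt
  push Not at hlt
  obtain ⟨_, hlt⟩ := hlt
  rw [← h2] at hlt
  by_contra! hge
  exact absurd (le_mul_of_one_le_left' hge) (not_le.2 hlt)

lemma exists_inv {U : Opens (Val P)} {s : ∀ v : U, Localization.AtPrime v.1.1.ker}
    (hs : s ∈ sectionsO P U) (v : U) (h1 : 1 ≤ stalkVal v.1 (s v)) :
    ∃ (V : Opens (Val P)) (hVU : V ≤ U), v.1 ∈ V ∧ ∃ t ∈ sectionsO P V,
      ∀ w : V, s ⟨w.1, hVU w.2⟩ * t w = 1 := by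
  obtain ⟨V, hvV, hVU, D, hD, x, hx, h⟩ := hs v.1 v.2
  rw [show s v = _ from h v.1 hvV] at h1
  obtain ⟨g, ⟨_, k, rfl⟩, hgk⟩ := IsLocalization.exists_mk'_eq (Submonoid.powers D.b) x
  have hx' : x * algebraMap P.B D.pair.B (D.b ^ k) = algebraMap P.B D.pair.B g := by
    rw [← hgk]; exact IsLocalization.mk'_spec _ _ _
  have hb0 := RatDatum.val_b_ne_zero (hD _ hvV)
  have hg : v.1.1.val (D.b ^ k) ≤ v.1.1.val g := by
    have := congrArg (fun y => stalkVal v.1 (D.germ v.1 (hD _ hvV) y)) hx'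
    simp only [map_mul, RatDatum.germ_algebraMap, stalkVal_algebraMap] at this
    rw [← this]
    exact le_mul_of_one_le_left' h1
  have hg0 : v.1.1.val g ≠ 0 := fun h0 => by
    rw [h0, map_pow, le_zero_iff] at hg
    exact hb0 (eq_zero_of_pow_eq_zero hg)
  obtain ⟨c, hc⟩ := (Spa.not_bounded_iff _).1 v.1.2 g hg0
  let E : RatDatum P :=
    { b := g * c
      T := {D.b ^ k * c, 1}
      finite := by simp
      span_eq_top := (Ideal.eq_top_iff_one _).2 (Ideal.subset_span (by simp)) }
  have hvE : v.1 ∈ E.dom := by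
    rintro a (rfl | rfl)
    · show _ ≤ v.1.1.val (g * c)
      rw [map_mul, map_mul]
      gcongr
    · rw [map_one]; exact hc
  let F := D.mul E
  have hbF : F.b = D.b * (g * c) := rfl
  have hmem : D.b * (D.b ^ k * c) ∈ F.T := ⟨D.b, Or.inl rfl, D.b ^ k * c, Or.inr (Or.inl rfl), rfl⟩
  let y : F.pair.B := IsLocalization.mk' (Localization.Away F.b) (D.b * (D.b ^ k * c))
    (⟨F.b, Submonoid.mem_powers F.b⟩ : Submonoid.powers F.b)
  have hy : y ∈ F.pair.nor.A := PaRing.le_nor _ (Subring.subset_closure (Or.inr ⟨_, hmem, rfl⟩))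
  have hy' : y * algebraMap P.B F.pair.B F.b = algebraMap P.B F.pair.B (D.b * (D.b ^ k * c)) :=
    IsLocalization.mk'_spec (Localization.Away F.b) _ _
  let V' : Opens (Val P) := V ⊓ ⟨E.dom, E.isOpen_dom⟩
  have hF : ∀ w ∈ V', w ∈ F.dom := fun w hw => RatDatum.mem_dom_mul (hD w hw.1) hw.2
  refine ⟨V', inf_le_left.trans hVU, ⟨hvV, hvE⟩, fun w => F.germ w.1 (hF _ w.2) y, ?_, ?_⟩
  · exact fun w hw => ⟨V', hw, le_rfl, F, hF, y, hy, fun _ _ => rfl⟩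
  · intro w
    rw [h w.1 w.2.1]
    have e1 := congrArg (D.germ w.1 (hD _ w.2.1)) hx'
    have e2 := congrArg (F.germ w.1 (hF _ w.2)) hy'
    simp only [map_mul, RatDatum.germ_algebraMap, hbF] at e1 e2
    have hu : IsUnit (algebraMap P.B (Localization.AtPrime w.1.1.ker) F.b) :=
      IsLocalization.map_units _ (⟨F.b, fun h0 => RatDatum.val_b_ne_zero (hF _ w.2)
        (Spa.mem_ker.1 h0)⟩ : w.1.1.ker.primeCompl)
    rw [hbF, map_mul, map_mul] at hu
    apply hu.mul_right_cancel
    have hu2 : IsUnit (algebraMap P.B (Localization.AtPrime w.1.1.ker) (D.b ^ k)) :=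
      IsLocalization.map_units _ (⟨D.b ^ k, fun h0 => RatDatum.val_b_ne_zero (hD _ w.2.1)
        (Spa.mem_ker.1 (Ideal.IsPrime.mem_of_pow_mem inferInstance _ h0))⟩ : w.1.1.ker.primeCompl)
    rw [mul_assoc, e2]
    linear_combination
      (algebraMap P.B (Localization.AtPrime w.1.1.ker) D.b *
        algebraMap P.B (Localization.AtPrime w.1.1.ker) c) * e1

lemma birHom_isLocal (φ : P ⟶ Q) : (birHom φ).IsLocal := by
  intro v
  refine ⟨fun a ha => ?_⟩
  obtain ⟨U, hU, s, rfl⟩ := (space P).toO.presheaf.exists_germ_eq a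
  have e := PresheafedSpace.stalkMap_germ_apply (PairRingedSpace.Hom.toO (birHom φ)).hom U v hU s
  change IsUnit ((PairRingedSpace.Hom.toO (birHom φ)).hom.stalkMap v _) at ha
  rw [e] at ha
  obtain ⟨V, i, hvV, hu⟩ := RingedSpace.isUnit_res_of_isUnit_germ (space Q).toO _ _ v _ ha
  obtain ⟨t, ht⟩ := hu.exists_right_inv
  have ht' : stalkHom φ v _ rfl (s.1.1 ⟨birMap φ v, hU⟩) * t.1.1 ⟨v, hvV⟩ = 1 :=
    congrFun (congrArg Subtype.val (congrArg Subtype.val ht)) ⟨v, hvV⟩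
  have hs1 : 1 ≤ stalkVal (birMap φ v) (s.1.1 ⟨birMap φ v, hU⟩) := by
    by_contra! hlt
    have h1 := stalkVal_stalkHom_lt φ v _ hlt
    have h2 : stalkVal v (t.1.1 ⟨v, hvV⟩) ≤ 1 := stalkVal_section_le t.2 ⟨v, hvV⟩
    have h3 := congrArg (stalkVal v) ht'
    rw [map_mul, map_one] at h3
    exact absurd h3 (mul_lt_one_of_lt_of_le h1 h2).ne
  obtain ⟨W, hWU, hw, t', ht', hst⟩ := exists_inv s.2 ⟨birMap φ v, hU⟩ hs1
  let s' : (space P).O W := (space P).toO.presheaf.map (homOfLE hWU).op s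
  let t'' : (space P).O W := ⟨⟨t', sectionsO_le P W ht'⟩, ht'⟩
  have hmul : s' * t'' = 1 := Subtype.ext (Subtype.ext (funext hst))
  have hs' : IsUnit s' := IsUnit.of_mul_eq_one _ hmul
  have hun : IsUnit ((space P).toO.presheaf.germ W (birMap φ v) hw
      ((space P).toO.presheaf.map (homOfLE hWU).op s)) :=
    hs'.map ((space P).toO.presheaf.germ W (birMap φ v) hw).hom
  exact (congrArg IsUnit (TopCat.Presheaf.germ_res_apply (space P).toO.presheaf (homOfLE hWU)
    (birMap φ v) hw s)).mp hun

end Val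

/-- An affinoid birational space: a pair-ringed space isomorphic to `Val(B, A)` for some pair of
rings. -/
structure AfBirat : Type (u + 1) where
  space : PairRingedSpace.{u}
  isAffinoid : ∃ P : PaRing.{u}, Nonempty (space ≅ Val.space P)

/-- Morphisms of affinoid birational spaces: morphisms of pair-ringed spaces which are maps of
locally ringed spaces for the sheaves `O`. -/
instance : Category.{u} AfBirat.{u} where
  Hom X Y := {f : X.space ⟶ Y.space // PairRingedSpace.Hom.IsLocal f}
  id X := ⟨𝟙 X.space, PairRingedSpace.isLocal_id X.space⟩
  comp f g := ⟨f.1 ≫ g.1, PairRingedSpace.isLocal_comp f.1 g.1 f.2 g.2⟩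

/-- The functor `bir`, sending `(B, A)` to `Val(B, A)` and `φ` to `φ_bir`. -/
def bir : PaRing.{u}ᵒᵖ ⥤ AfBirat.{u} where
  obj P := ⟨Val.space P.unop, P.unop, ⟨Iso.refl _⟩⟩
  map φ := ⟨Val.birHom φ.unop, Val.birHom_isLocal φ.unop⟩
  map_id _ := Subtype.ext Val.birHom_id
  map_comp φ ψ := Subtype.ext (Val.birHom_comp ψ.unop φ.unop)

/-- The canonical map `B → Γ(Val(B, A), M)`. -/
def toGlobal (P : PaRing.{u}) : P.B →+* (Val.space P).toM.presheaf.obj (op ⊤) where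
  toFun x := ⟨fun v => algebraMap P.B (Localization.AtPrime v.1.1.ker) x, fun v hv =>
    ⟨⊤, hv, le_rfl, ⟨1, ∅, Set.finite_empty, by simp⟩, fun _ _ a ha => absurd ha (Set.notMem_empty a),
      algebraMap P.B _ x, trivial, fun w _ => (RatDatum.germ_algebraMap _ _ _ _).symm⟩⟩
  map_one' := Subtype.ext (funext fun _ => map_one _)
  map_mul' _ _ := Subtype.ext (funext fun _ => map_mul _ _ _)
  map_zero' := Subtype.ext (funext fun _ => map_zero _)
  map_add' _ _ := Subtype.ext (funext fun _ => map_add _ _ _)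

/-- The map on global sections `Γ(Y, M_Y) → Γ(X, M_X)` induced by a morphism `X → Y`. -/
def globalMap {X Y : PairRingedSpace.{u}} (h : X ⟶ Y) :
    Y.toM.presheaf.obj (op ⊤) →+* X.toM.presheaf.obj (op ⊤) :=
  (PairRingedSpace.Hom.hom h).hom.c.app (op ⊤) |>.hom

end Birational

end

open Birational

/-!
The theorem rests on the computation of global sections and on a rigidity property of local
morphisms.

*Global sections.* Every prime ideal of `B` is the kernel of a trivial valuation, these valuations
form a copy of `Spec B` inside `Val(B, A)`, and every point `v` is a specialization of the trivial
valuation with the same kernel and hence the same local ring (`Val.triv_ker_specializes`). A section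
of `M` is therefore determined by its restriction to `Spec B`, where it is a section of the structure
sheaf, so that `Γ(Val(B, A), M) = B` (`toGlobal_bijective`). An element of `B` lies in
`Γ(Val(B, A), O)` if and only if all unbounded valuations are at most `1` on it; if `x` is not integral
over `A`, then `1 / x` is not a unit in `A[1 / x] ⊆ B_x`, and a valuation ring dominating a local ring
of `A[1 / x]` in which `1 / x` is not a unit gives a valuation `v` with `v x > 1`, which the retraction
to `Val(B, A)` preserves (`isIntegral_of_forall_val_le_one`).

*Local morphisms.* The stalk of `O` at `w` consists of the germs `f` of `M` with `w f ≤ 1`, and its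
units are those with `w f = 1`. If `h : Val(B', A') → Val(B, A)` is a local morphism with comorphism
`φ : B → B'` and `w = h v`, then applying `h` to germs `a / b` of `O` shows that `w a ≤ w b ≠ 0` implies
`v (φ a) ≤ v (φ b)`, and locality gives the same for strict inequalities. Since `w` is unbounded, this
forces `w = r (v ∘ φ)` (`Val.base_le_iff`); on sections `h` is determined by `φ` because these are
locally fractions. Hence `h` is determined by `φ` (`Val.ext_of_comorphism_eq`).

*The equivalence.* The identity of valuations and of local rings is an inverse to
`Val(B, Nor_B A) → Val(B, A)`. Thus `bir` inverts the relative normalizations, and every homomorphism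
of normalized pairs comes from a morphism of spaces. In the localized category every morphism
`(B, A) → (B', A')` becomes, after composition with relative normalizations, a homomorphism
`(B, Nor_B A) → (B', Nor_{B'} A')` (`PaRing.isInducedByNor`), so the induced functor is fully
faithful, and it is essentially surjective since isomorphisms of pair-ringed spaces are local.
-/

/-! ### Glueing functions on the prime spectrum -/

lemma LocalizedModule.eq_mk_of_mul_algebraMap_eq {R : Type*} [CommRing R] {S : Submonoid R}
    {x : LocalizedModule S R} (a : R) (f : S)
    (h : x * algebraMap R _ (f : R) = algebraMap R _ a) : x = LocalizedModule.mk a f := by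
  apply (IsLocalization.map_units (LocalizedModule S R) f).mul_right_cancel
  rw [h]
  change LocalizedModule.mk a 1 = LocalizedModule.mk a f * LocalizedModule.mk (f : R) 1
  refine Eq.trans ?_ (LocalizedModule.mk_mul_mk (A := R)).symm
  rw [LocalizedModule.mk_eq]
  exact ⟨1, by simp [Submonoid.smul_def, mul_comm]⟩

open AlgebraicGeometry in
/-- `Γ(Spec R, 𝒪) = R` for functions with values in any models `L p` of the local rings `R_p`. -/
lemma PrimeSpectrum.exists_eq_algebraMap_of_locally_fraction {R : Type u} [CommRing R]
    (L : PrimeSpectrum R → Type u) [∀ p, CommRing (L p)] [∀ p, Algebra R (L p)]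
    [∀ p, IsLocalization.AtPrime (L p) p.asIdeal] (s : ∀ p, L p)
    (hs : ∀ p : PrimeSpectrum R, ∃ U : Opens (PrimeSpectrum R), p ∈ U ∧ ∃ a f : R, ∀ q ∈ U,
      f ∉ q.asIdeal ∧ s q * algebraMap R _ f = algebraMap R _ a) :
    ∃ r : R, ∀ p, s p = algebraMap R _ r := by
  let e : ∀ p : PrimeSpectrum R, L p ≃ₐ[R] StructureSheaf.Localizations R p :=
    fun p => IsLocalization.algEquiv p.asIdeal.primeCompl _ _
  have h : ∀ (p : PrimeSpectrum R) (a f : R) (hf : f ∉ p.asIdeal),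
      s p * algebraMap R _ f = algebraMap R _ a → e p (s p) = LocalizedModule.mk a ⟨f, hf⟩ := by
    intro p a f hf h
    refine LocalizedModule.eq_mk_of_mul_algebraMap_eq (S := p.asIdeal.primeCompl) a ⟨f, hf⟩ ?_
    have h' := congrArg (e p) h
    rw [map_mul, AlgEquiv.commutes, AlgEquiv.commutes] at h'
    exact h'
  obtain ⟨r, hr⟩ := StructureSheaf.algebraMap_obj_top_bijective.2
    (⟨fun p => e p.1 (s p.1), by
      rintro ⟨p, -⟩
      obtain ⟨U, hp, a, f, hU⟩ := hs p
      exact ⟨U, hp, homOfLE le_top, a, f, fun q => ⟨(hU q.1 q.2).1, h _ _ _ _ (hU q.1 q.2).2⟩⟩⟩ :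
      (structureSheafInType R R).obj.obj (op (⊤ : Opens (PrimeSpectrum R))))
  refine ⟨r, fun p => ?_⟩
  have := congrFun (congrArg Subtype.val hr) ⟨p, trivial⟩
  apply (e p).injective
  rw [AlgEquiv.commutes]
  exact this.symm

namespace Birational

open AlgebraicGeometry

variable {P Q R : PaRing.{u}}

/-! ### Integral elements and valuations -/

/-- If the inverse of `x` generates the unit ideal of `A[1/x] ⊆ B_x`, clearing denominators in
a relation `1 = x⁻¹ f(x⁻¹)` yields an integral equation for `x`. -/
lemma isIntegral_of_span_invSelf_eq_top {A B : Type*} [CommRing A] [Nontrivial A] [CommRing B]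
    [Algebra A B] (x : B)
    (h : Ideal.span {(⟨IsLocalization.Away.invSelf x, Algebra.subset_adjoin rfl⟩ :
      Algebra.adjoin A {(IsLocalization.Away.invSelf x : Localization.Away x)})} = ⊤) :
    IsIntegral A x := by
  let y : Localization.Away x := IsLocalization.Away.invSelf x
  have hxy : algebraMap B (Localization.Away x) x * y = 1 := IsLocalization.Away.mul_invSelf x
  let : Invertible y := ⟨algebraMap B _ x, hxy, by rw [mul_comm]; exact hxy⟩
  obtain ⟨p, hp, hp0⟩ := Algebra.exists_aeval_invOf_eq_zero_of_idealMap_adjoin_sup_span_eq_top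
    (R := A) y ⊥ bot_ne_top (by rw [Ideal.map_bot, bot_sup_eq]; exact h)
  have hp0' : algebraMap B (Localization.Away x) (Polynomial.aeval x p) = 0 := by
    rw [← Polynomial.aeval_algebraMap_apply]; exact hp0
  obtain ⟨⟨_, n, rfl⟩, hn⟩ :=
    (IsLocalization.map_eq_zero_iff (Submonoid.powers x) (Localization.Away x) _).1 hp0'
  refine ⟨Polynomial.X ^ n * p, (Polynomial.monic_X_pow n).mul (sub_eq_zero.1 hp), ?_⟩
  rw [← Polynomial.aeval_def, map_mul, map_pow, Polynomial.aeval_X]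
  exact hn

/-- A non-unit `y` of a subring of `S` is made small by a valuation of `S` which is bounded by `1`
on that subring: a minimal prime below a maximal ideal containing `y` is the trace of a prime `q` of
`S`, and a valuation ring of the residue field of `q` dominates the local ring in question. -/
lemma exists_valuation_lt_one {A : Type*} {S : Type u} [CommRing A] [CommRing S] [Algebra A S]
    (R : Subalgebra A S) (y : R) (hy : Ideal.span {y} ≠ ⊤) :
    ∃ (Γ : Type u) (_ : LinearOrderedCommGroupWithZero Γ) (v : Valuation S Γ),
      (∀ a : R, v a ≤ 1) ∧ v y < 1 := by
  obtain ⟨m, hm, hym⟩ := Ideal.exists_le_maximal _ hy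
  rw [Ideal.span_singleton_le_iff_mem] at hym
  obtain ⟨p, hp, hpm⟩ := Ideal.exists_minimalPrimes_le (I := (⊥ : Ideal R)) (J := m) bot_le
  obtain ⟨q, hq, hqp⟩ := Ideal.exists_comap_eq_of_mem_minimalPrimes_of_injective
    (f := R.val.toRingHom) Subtype.val_injective p hp
  let K := FractionRing (S ⧸ q)
  let g : S →+* K := (algebraMap (S ⧸ q) K).comp (Ideal.Quotient.mk q)
  have hg : ∀ s, g s = 0 ↔ s ∈ q := fun s => by
    rw [← Ideal.Quotient.eq_zero_iff_mem]
    exact (map_eq_zero_iff _ (IsFractionRing.injective (S ⧸ q) K))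
  have hu : ∀ s : m.primeCompl, IsUnit (g.comp R.val.toRingHom s) := fun s => by
    rw [isUnit_iff_ne_zero]
    intro h0
    refine s.2 (hpm ?_)
    rw [← hqp]
    exact (hg _).1 h0
  let f : Localization.AtPrime m →+* K := IsLocalization.lift (M := m.primeCompl) hu
  have hf : ∀ a : R, f (algebraMap R _ a) = g a := fun a => IsLocalization.lift_eq hu a
  obtain ⟨V, hV, hloc⟩ := IsLocalRing.exists_factor_valuationRing f
  refine ⟨_, inferInstance, V.valuation.comap g, fun a => ?_, ?_⟩
  · show V.valuation (g a) ≤ 1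
    rw [← hf]
    exact (V.valuation_le_one_iff _).2 (hV _)
  · show V.valuation (g y) < 1
    rw [← hf]
    have hnu : ¬ IsUnit (algebraMap R (Localization.AtPrime m) y) := fun h =>
      (IsLocalization.AtPrime.isUnit_to_map_iff (Localization.AtPrime m) m y).1 h hym
    refine (V.valuation_lt_one_iff ⟨_, hV _⟩).1 ?_
    rw [IsLocalRing.mem_maximalIdeal]
    exact fun h => hnu (hloc.map_nonunit _ h)

lemma isIntegral_of_forall_val_le_one {P : PaRing.{u}} (x : P.B)
    (h : ∀ v : Val P, v.1.val x ≤ 1) : IsIntegral P.A x := by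
  nontriviality P.B
  by_contra hx
  obtain ⟨Γ, _, w, hw, hlt⟩ := exists_valuation_lt_one _ _
    (mt (isIntegral_of_span_invSelf_eq_top (A := P.A) x) hx)
  have hmul : w (algebraMap P.B (Localization.Away x) x) * w (IsLocalization.Away.invSelf x) = 1 := by
    rw [← map_mul, IsLocalization.Away.mul_invSelf, map_one]
  let v : Spa P := Spa.ofValuation (w.comap (algebraMap P.B (Localization.Away x)))
    fun a ha => hw (algebraMap P.A _ ⟨a, ha⟩)
  have h1 : v.val 1 ≤ v.val x := by
    refine (Spa.ofValuation_le_iff _ _ 1 x).2 ?_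
    rw [map_one]
    by_contra! hlt'
    exact (mul_lt_one_of_lt_of_le hlt' hlt.le).ne hmul
  have h2 : ¬ v.val x ≤ v.val 1 := by
    intro hle
    replace hle := (Spa.ofValuation_le_iff _ _ x 1).1 hle
    rw [map_one] at hle
    rw [mul_comm] at hmul
    exact (mul_lt_one_of_lt_of_le hlt hle).ne hmul
  -- the retraction onto `Val` does not change whether `x` has value greater than `1`
  have h3 := h (Val.r v)
  rw [← map_one (Val.r v).1.val] at h3
  exact h2 ((Spa.retract_le_iff v x 1).1 h3 ⟨1, by rw [mul_one, ← map_one v.val]; exact h1⟩)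

/-! ### Trivial valuations -/

namespace Val

open Classical in
/-- The trivial valuation with kernel `p`, as a point of `Spa(B, A)`. -/
noncomputable def _root_.Birational.Spa.triv (p : PrimeSpectrum P.B) : Spa P :=
  Spa.ofValuation ((1 : Valuation (P.B ⧸ p.asIdeal) (WithZero (Multiplicative ℤ))).comap
    (Ideal.Quotient.mk p.asIdeal)) fun a _ => by
      rw [Valuation.comap_apply]; exact Valuation.one_apply_le_one _

lemma _root_.Birational.Spa.triv_le_iff (p : PrimeSpectrum P.B) (a b : P.B) :
    (Spa.triv p).val a ≤ (Spa.triv p).val b ↔ (b ∈ p.asIdeal → a ∈ p.asIdeal) := by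
  classical
  rw [Spa.triv, Spa.ofValuation_le_iff]
  simp only [Valuation.comap_apply, Valuation.one_apply_def, Ideal.Quotient.eq_zero_iff_mem]
  split_ifs with h1 h2 <;> simp [*]

/-- The trivial valuation with kernel `p`, as a point of `Val(B, A)`. -/
noncomputable def triv (p : PrimeSpectrum P.B) : Val P :=
  ⟨Spa.triv p, by
    rw [Spa.not_bounded_iff]
    intro s hs
    refine ⟨1, ?_⟩
    rw [mul_one, ← map_one (Spa.val _), Spa.triv_le_iff]
    refine fun h => absurd ?_ hs
    rw [← le_zero_iff, ← map_zero (Spa.val _), Spa.triv_le_iff]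
    exact fun _ => h⟩

lemma triv_le_iff (p : PrimeSpectrum P.B) (a b : P.B) :
    (triv p).1.val a ≤ (triv p).1.val b ↔ (b ∈ p.asIdeal → a ∈ p.asIdeal) :=
  Spa.triv_le_iff p a b

lemma triv_eq_zero_iff (p : PrimeSpectrum P.B) (b : P.B) :
    (triv p).1.val b = 0 ↔ b ∈ p.asIdeal := by
  rw [← le_zero_iff, ← map_zero (Spa.val _), triv_le_iff]
  simp

lemma triv_le_of_ne_zero (p : PrimeSpectrum P.B) (a b : P.B) (hb : (triv p).1.val b ≠ 0) :
    (triv p).1.val a ≤ (triv p).1.val b :=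
  (triv_le_iff p a b).2 fun h => absurd ((triv_eq_zero_iff p b).2 h) hb

lemma ker_triv (p : PrimeSpectrum P.B) : (triv p).1.ker = p.asIdeal := by
  ext b
  rw [Spa.mem_ker, triv_eq_zero_iff]

lemma continuous_triv : Continuous (triv : PrimeSpectrum P.B → Val P) := by
  refine continuous_induced_rng.2 (continuous_generateFrom_iff.2 ?_)
  rintro _ ⟨a, b, rfl⟩
  convert (PrimeSpectrum.basicOpen b).isOpen using 1
  ext p
  refine ⟨fun h => mt (triv_eq_zero_iff p b).2 h.2, fun h => ?_⟩
  have hb : (triv p).1.val b ≠ 0 := mt (triv_eq_zero_iff p b).1 h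
  exact ⟨triv_le_of_ne_zero p a b hb, hb⟩

/-- Every point of `Val(B, A)` is a specialization of the trivial valuation with the same kernel,
so the trivial valuations see every open set. -/
lemma triv_ker_specializes (v : Val P) : triv ⟨v.1.ker, inferInstance⟩ ⤳ v := by
  refine Topology.IsInducing.subtypeVal.specializes_iff.1 (specializes_iff_forall_open.2 ?_)
  intro W hW
  induction hW with
  | basic W hW =>
    obtain ⟨a, b, rfl⟩ := hW
    rintro ⟨-, hb⟩
    have hb' : (triv ⟨v.1.ker, inferInstance⟩).1.val b ≠ 0 := fun h =>
      hb (Spa.mem_ker.1 ((triv_eq_zero_iff _ b).1 h))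
    exact ⟨triv_le_of_ne_zero _ a b hb', hb'⟩
  | univ => exact fun _ => trivial
  | inter _ _ _ _ h1 h2 => exact fun h => ⟨h1 h.1, h2 h.2⟩
  | sUnion _ _ h =>
    rintro ⟨W, hW, hv⟩
    exact ⟨W, hW, h W hW hv⟩

instance (p : PrimeSpectrum P.B) :
    IsLocalization.AtPrime (Localization.AtPrime (triv p).1.ker) p.asIdeal := by
  have key : ∀ {I J : Ideal P.B} [I.IsPrime] [J.IsPrime] (_ : I = J),
      IsLocalization.AtPrime (Localization.AtPrime I) J := by
    rintro I J _ _ rfl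
    infer_instance
  exact key (ker_triv p)

lemma algebraMap_triv_eq_iff (p : PrimeSpectrum P.B) (a b : P.B) :
    algebraMap P.B (Localization.AtPrime (triv p).1.ker) a = algebraMap P.B _ b ↔
      ∃ c : p.asIdeal.primeCompl, c * a = c * b :=
  IsLocalization.eq_iff_exists p.asIdeal.primeCompl _

end Val

/-! ### Global sections -/

/-- An element of `B_b` is a fraction `g / b ^ k`, and so are its germs. -/
lemma RatDatum.exists_germ_mul_pow_eq (D : RatDatum P) (x : D.pair.B) :
    ∃ (g : P.B) (k : ℕ), ∀ v (hv : v ∈ D.dom),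
      D.germ v hv x * algebraMap P.B _ (D.b ^ k) = algebraMap P.B _ g := by
  obtain ⟨g, ⟨_, k, rfl⟩, hgk⟩ := IsLocalization.exists_mk'_eq (Submonoid.powers D.b) x
  refine ⟨g, k, fun v hv => ?_⟩
  rw [← RatDatum.germ_algebraMap D v hv, ← RatDatum.germ_algebraMap D v hv, ← map_mul]
  congr 1
  rw [← hgk]
  exact IsLocalization.mk'_spec _ _ _

lemma RatDatum.isUnit_algebraMap_pow (D : RatDatum P) {v : Val P} (hv : v ∈ D.dom) (k : ℕ) :
    IsUnit (algebraMap P.B (Localization.AtPrime v.1.ker) (D.b ^ k)) := by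
  rw [map_pow]
  exact (IsLocalization.map_units (Localization.AtPrime v.1.ker)
    (⟨D.b, fun h0 => RatDatum.val_b_ne_zero hv (Spa.mem_ker.1 h0)⟩ : v.1.ker.primeCompl)).pow k

lemma toGlobal_injective (P : PaRing.{u}) : Function.Injective (toGlobal P) := by
  rw [injective_iff_map_eq_zero]
  intro x hx
  refine eq_zero_of_localization x fun J hJ => ?_
  have h : algebraMap P.B (Localization.AtPrime (Val.triv ⟨J, hJ.isPrime⟩).1.ker) x = 0 :=
    congrFun (congrArg Subtype.val hx) ⟨Val.triv ⟨J, hJ.isPrime⟩, trivial⟩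
  rw [← map_zero (algebraMap P.B _), Val.algebraMap_triv_eq_iff] at h
  rw [← map_zero (algebraMap P.B _)]
  exact (IsLocalization.eq_iff_exists J.primeCompl _).2 h

/-- Sections of `M` are determined on the trivial valuations, where they are sections of the
structure sheaf of `Spec B`. -/
lemma toGlobal_surjective (P : PaRing.{u}) : Function.Surjective (toGlobal P) := by
  rintro ⟨s, hs⟩
  obtain ⟨r, hr⟩ := PrimeSpectrum.exists_eq_algebraMap_of_locally_fraction
    (fun p : PrimeSpectrum P.B => Localization.AtPrime (Val.triv p).1.ker)
    (fun p => s ⟨Val.triv p, trivial⟩) fun p => by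
      obtain ⟨V, hpV, hV, D, hD, x, -, h⟩ := hs (Val.triv p) trivial
      obtain ⟨g, k, hgk⟩ := D.exists_germ_mul_pow_eq x
      refine ⟨⟨Val.triv ⁻¹' V, V.2.preimage Val.continuous_triv⟩, hpV, g, D.b ^ k, fun q hq => ?_⟩
      refine ⟨fun hb => RatDatum.val_b_ne_zero (hD _ hq) ?_, ?_⟩
      · rw [Val.triv_eq_zero_iff]
        exact q.isPrime.mem_of_pow_mem _ hb
      · rw [h _ hq]
        exact hgk _ _
  refine ⟨r, Subtype.ext (funext fun ⟨v, hv⟩ => ?_)⟩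
  obtain ⟨V, hvV, hV, D, hD, x, -, h⟩ := hs v trivial
  obtain ⟨g, k, hgk⟩ := D.exists_germ_mul_pow_eq x
  let p : PrimeSpectrum P.B := ⟨v.1.ker, inferInstance⟩
  have hpV : Val.triv p ∈ V := (Val.triv_ker_specializes v).mem_open V.2 hvV
  have h1 := hgk _ (hD _ hpV)
  rw [← h _ hpV, hr p, ← map_mul] at h1
  show algebraMap P.B (Localization.AtPrime v.1.ker) r = s ⟨v, hv⟩
  apply (D.isUnit_algebraMap_pow (hD v hvV) k).mul_right_cancel
  rw [h v hvV, hgk, ← map_mul]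
  exact (IsLocalization.eq_iff_exists v.1.ker.primeCompl _).2
    ((Val.algebraMap_triv_eq_iff p _ _).1 h1)

lemma toGlobal_bijective (P : PaRing.{u}) : Function.Bijective (toGlobal P) :=
  ⟨toGlobal_injective P, toGlobal_surjective P⟩

lemma RatDatum.algebraMap_mem_nor (D : RatDatum P) {x : P.B} (hx : x ∈ P.nor.A) :
    algebraMap P.B D.pair.B x ∈ D.pair.nor.A :=
  PaRing.Hom.map_nor (Q := D.pair)
    ⟨algebraMap P.B D.pair.B, fun a ha => Subring.subset_closure (Or.inl ⟨a, ha, rfl⟩)⟩ hx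

lemma toGlobal_mem_O_iff (x : P.B) : toGlobal P x ∈ (Val.space P).O ⊤ ↔ x ∈ P.nor.A := by
  constructor
  · intro h
    refine isIntegral_of_forall_val_le_one x fun v => ?_
    rw [← Val.stalkVal_algebraMap]
    exact Val.stalkVal_section_le h ⟨v, trivial⟩
  · intro hx v hv
    let D : RatDatum P := ⟨1, ∅, Set.finite_empty, by simp⟩
    exact ⟨⊤, hv, le_rfl, D, fun _ _ a ha => absurd ha (Set.notMem_empty a),
      algebraMap P.B _ x, D.algebraMap_mem_nor hx,
      fun w _ => (RatDatum.germ_algebraMap _ _ _ _).symm⟩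

/-! ### Local morphisms -/

namespace Val

/-- The pull back of sections of `M` along a morphism `h : Val(B', A') → Val(B, A)`. -/
noncomputable def pullHom (h : space Q ⟶ space P) (U : Opens (Val P)) :
    sectionsM P U →+* sectionsM Q ((Opens.map h.hom.hom.base).obj U) :=
  (h.hom.hom.c.app (op U)).hom

/-- The value in the local ring at `v` of the pull back along `h` of a section defined near `h v`. -/
noncomputable def evalAt (h : space Q ⟶ space P) (U : Opens (Val P)) (v : Val Q)
    (hv : h.hom.hom.base v ∈ U) : sectionsM P U →+* Localization.AtPrime v.1.ker :=
  (Pi.evalRingHom (fun w : (Opens.map h.hom.hom.base).obj U => Localization.AtPrime w.1.1.ker)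
    ⟨v, hv⟩).comp ((sectionsM Q _).subtype.comp (pullHom h U))

lemma evalAt_res (h : space Q ⟶ space P) {U V : Opens (Val P)} (i : V ≤ U) (v : Val Q)
    (hv : h.hom.hom.base v ∈ V) (s : sectionsM P U) :
    evalAt h V v hv ⟨fun w => s.1 ⟨w.1, i w.2⟩, IsSection.res i s.2⟩ = evalAt h U v (i hv) s :=
  congrFun (congrArg Subtype.val
    (show pullHom h V ⟨fun w => s.1 ⟨w.1, i w.2⟩, IsSection.res i s.2⟩ =
        ((space Q).toM.presheaf.map ((Opens.map h.hom.hom.base).map (homOfLE i)).op).hom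
          (pullHom h U s) from
      ConcreteCategory.congr_hom (h.hom.hom.c.naturality (homOfLE i).op) s)) ⟨v, hv⟩

lemma pullHom_mem_sectionsO (h : space Q ⟶ space P) {U : Opens (Val P)} {s : sectionsM P U}
    (hs : s.1 ∈ sectionsO P U) : (pullHom h U s).1 ∈ sectionsO Q _ :=
  PairRingedSpace.Hom.map_O h U s hs

/-- The stalk of `O` at `v` consists of germs `f` with `v f ≤ 1`, and those with `v f = 1` are its
units. -/
lemma isUnit_germ_iff {U : Opens (Val P)} (s : (space P).O U) (v : Val P) (hv : v ∈ U) :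
    IsUnit ((space P).toO.presheaf.germ U v hv s) ↔ 1 ≤ stalkVal v (s.1.1 ⟨v, hv⟩) := by
  constructor
  · intro hu
    obtain ⟨V, i, hvV, hu⟩ := RingedSpace.isUnit_res_of_isUnit_germ (space P).toO _ s v _ hu
    obtain ⟨t, ht⟩ := hu.exists_right_inv
    have ht' : s.1.1 ⟨v, hv⟩ * t.1.1 ⟨v, hvV⟩ = 1 :=
      congrFun (congrArg Subtype.val (congrArg Subtype.val ht)) ⟨v, hvV⟩
    have h2 : stalkVal v (t.1.1 ⟨v, hvV⟩) ≤ 1 := stalkVal_section_le t.2 ⟨v, hvV⟩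
    have h3 := congrArg (stalkVal v) ht'
    rw [map_mul, map_one] at h3
    by_contra! hlt
    exact absurd h3 (mul_lt_one_of_lt_of_le hlt h2).ne
  · intro h1
    obtain ⟨W, hWU, hw, t, ht, hst⟩ := exists_inv s.2 ⟨v, hv⟩ h1
    let s' : (space P).O W := (space P).toO.presheaf.map (homOfLE hWU).op s
    let t' : (space P).O W := ⟨⟨t, sectionsO_le P W ht⟩, ht⟩
    have hmul : s' * t' = 1 := Subtype.ext (Subtype.ext (funext hst))
    have hun : IsUnit ((space P).toO.presheaf.germ W v hw
        ((space P).toO.presheaf.map (homOfLE hWU).op s)) :=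
      (IsUnit.of_mul_eq_one _ hmul : IsUnit s').map ((space P).toO.presheaf.germ W v hw).hom
    exact (congrArg IsUnit (TopCat.Presheaf.germ_res_apply (space P).toO.presheaf (homOfLE hWU)
      v hw s)).mp hun

/-- Locality, expressed by the valuations at `v` and `h v` instead of the stalks of `O`. -/
lemma isLocal_iff (h : space Q ⟶ space P) :
    PairRingedSpace.Hom.IsLocal h ↔ ∀ (U : Opens (Val P)) (s : sectionsM P U)
      (_ : s.1 ∈ sectionsO P U) (v : Val Q) (hv : h.hom.hom.base v ∈ U),
      stalkVal _ (s.1 ⟨h.hom.hom.base v, hv⟩) < 1 → stalkVal v (evalAt h U v hv s) < 1 := by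
  have key : ∀ (U : Opens (Val P)) (s : (space P).O U) (v : Val Q) (hv : h.hom.hom.base v ∈ U),
      IsUnit ((PairRingedSpace.Hom.toO h).hom.stalkMap v
        ((space P).toO.presheaf.germ U (h.hom.hom.base v) hv s)) ↔
      1 ≤ stalkVal v (evalAt h U v hv s.1) := fun U s v hv => by
    have e := PresheafedSpace.stalkMap_germ_apply (PairRingedSpace.Hom.toO h).hom U v hv s
    refine (congrArg IsUnit e).to_iff.trans ?_
    exact isUnit_germ_iff ((PairRingedSpace.Hom.toO h).hom.c.app (op U) s) v hv
  constructor
  · intro hl U s hs v hv hlt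
    by_contra! h1
    have h2 := (hl v).map_nonunit _ ((key U ⟨s, hs⟩ v hv).2 h1)
    exact absurd ((isUnit_germ_iff (P := P) _ _ _).1 h2) (not_le.2 hlt)
  · refine fun hc v => ⟨fun a ha => ?_⟩
    obtain ⟨U, hU, s, rfl⟩ := (space P).toO.presheaf.exists_germ_eq a
    refine (isUnit_germ_iff (P := P) _ _ _).2 ?_
    by_contra! hlt
    exact absurd ((key U s v hU).1 ha) (not_le.2 (hc U s.1 s.2 v hU hlt))

/-- The comorphism `B → B'` on global sections of a morphism `Val(B', A') → Val(B, A)`. -/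
noncomputable def comorphism (h : space Q ⟶ space P) : P.B →+* Q.B :=
  ((RingEquiv.ofBijective (toGlobal Q) (toGlobal_bijective Q)).symm.toRingHom.comp
    (globalMap h)).comp (toGlobal P)

lemma toGlobal_comorphism (h : space Q ⟶ space P) (x : P.B) :
    toGlobal Q (comorphism h x) = globalMap h (toGlobal P x) :=
  (RingEquiv.ofBijective (toGlobal Q) (toGlobal_bijective Q)).apply_symm_apply _

lemma comorphism_eq_iff (h : space Q ⟶ space P) (f : P.B →+* Q.B) :
    comorphism h = f ↔ ∀ x, globalMap h (toGlobal P x) = toGlobal Q (f x) := by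
  simp only [← toGlobal_comorphism, (toGlobal_injective Q).eq_iff, RingHom.ext_iff]

lemma comorphism_mem_nor (h : space Q ⟶ space P) {x : P.B} (hx : x ∈ P.nor.A) :
    comorphism h x ∈ Q.nor.A := by
  rw [← toGlobal_mem_O_iff, toGlobal_comorphism]
  exact PairRingedSpace.Hom.map_O h ⊤ _ ((toGlobal_mem_O_iff x).2 hx)

/-- The constant section of `M` with value `x`. -/
noncomputable def const (U : Opens (Val P)) (x : P.B) : sectionsM P U :=
  ⟨fun v => algebraMap P.B (Localization.AtPrime v.1.1.ker) x,
    IsSection.res le_top (toGlobal P x).2⟩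

lemma evalAt_const (h : space Q ⟶ space P) (U : Opens (Val P)) (v : Val Q)
    (hv : h.hom.hom.base v ∈ U) (x : P.B) :
    evalAt h U v hv (const U x) = algebraMap Q.B _ (comorphism h x) := by
  have h1 := evalAt_res h (le_top : U ≤ ⊤) v hv (toGlobal P x)
  refine h1.trans ?_
  exact (congrFun (congrArg Subtype.val (toGlobal_comorphism h x)) ⟨v, trivial⟩).symm

lemma evalAt_mul_eq (h : space Q ⟶ space P) {U : Opens (Val P)} (s : sectionsM P U) (a b : P.B)
    (hs : ∀ w : U, s.1 w * algebraMap P.B _ b = algebraMap P.B _ a) (v : Val Q)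
    (hv : h.hom.hom.base v ∈ U) :
    evalAt h U v hv s * algebraMap Q.B _ (comorphism h b) =
      algebraMap Q.B _ (comorphism h a) := by
  rw [← evalAt_const h U v hv, ← evalAt_const h U v hv, ← map_mul]
  congr 1
  exact Subtype.ext (funext hs)

/-- If `w a ≤ w b` and `w b ≥ 1` then `a / b` is a section of `O` near `w`. -/
lemma exists_section_div (w : Val P) (a b : P.B) (hab : w.1.val a ≤ w.1.val b)
    (hb : 1 ≤ w.1.val b) : ∃ (U : Opens (Val P)) (_ : w ∈ U) (s : sectionsM P U),
      s.1 ∈ sectionsO P U ∧ ∀ w : U, s.1 w * algebraMap P.B _ b = algebraMap P.B _ a := by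
  -- including `1` among the numerators makes them generate the unit ideal
  let D : RatDatum P :=
    { b := b
      T := {a, 1}
      finite := by simp
      span_eq_top := (Ideal.eq_top_iff_one _).2 (Ideal.subset_span (by simp)) }
  have hw : w ∈ D.dom := by
    rintro c (rfl | rfl)
    · exact hab
    · rw [map_one]; exact hb
  let y : D.pair.B := IsLocalization.mk' (Localization.Away D.b) a
    (⟨D.b, Submonoid.mem_powers D.b⟩ : Submonoid.powers D.b)
  have hy : y ∈ D.pair.nor.A :=
    PaRing.le_nor _ (Subring.subset_closure (Or.inr ⟨_, Or.inl rfl, rfl⟩))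
  have hy' : y * algebraMap P.B D.pair.B b = algebraMap P.B D.pair.B a :=
    IsLocalization.mk'_spec (Localization.Away D.b) _ _
  let U : Opens (Val P) := ⟨D.dom, D.isOpen_dom⟩
  have hs : (fun w : U => D.germ w.1 w.2 y) ∈ sectionsO P U :=
    fun w hw => ⟨U, hw, le_rfl, D, fun _ h => h, y, hy, fun _ _ => rfl⟩
  refine ⟨U, hw, ⟨_, sectionsO_le P U hs⟩, hs, fun w => ?_⟩
  have := congrArg (D.germ w.1 w.2) hy'
  rwa [map_mul, RatDatum.germ_algebraMap, RatDatum.germ_algebraMap] at this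

/-- The germ `a / b` of `O` at `h v` is pulled back to a germ of `O` at `v`. -/
lemma val_comorphism_le (h : space Q ⟶ space P) (v : Val Q) (a b : P.B)
    (hab : (h.hom.hom.base v : Val P).1.val a ≤ (h.hom.hom.base v : Val P).1.val b)
    (hb : 1 ≤ (h.hom.hom.base v : Val P).1.val b) :
    v.1.val (comorphism h a) ≤ v.1.val (comorphism h b) := by
  obtain ⟨U, hU, s, hs, hsab⟩ := exists_section_div (h.hom.hom.base v : Val P) a b hab hb
  have h1 := congrArg (stalkVal v) (evalAt_mul_eq h s a b hsab v hU)
  rw [map_mul, stalkVal_algebraMap, stalkVal_algebraMap] at h1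
  rw [← h1]
  exact mul_le_of_le_one_left' (stalkVal_section_le (pullHom_mem_sectionsO h hs) ⟨v, hU⟩)

lemma one_le_val_comorphism (h : space Q ⟶ space P) (v : Val Q) (b : P.B)
    (hb : 1 ≤ (h.hom.hom.base v : Val P).1.val b) : 1 ≤ v.1.val (comorphism h b) := by
  have := val_comorphism_le h v 1 b (by rwa [map_one]) hb
  rwa [map_one, map_one] at this

lemma val_comorphism_ne_zero (h : space Q ⟶ space P) (v : Val Q) (b : P.B)
    (hb : (h.hom.hom.base v : Val P).1.val b ≠ 0) : v.1.val (comorphism h b) ≠ 0 := by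
  obtain ⟨c, hc⟩ := (Spa.not_bounded_iff _).1 (h.hom.hom.base v : Val P).2 b hb
  have h1 := one_le_val_comorphism h v _ hc
  intro h0
  rw [map_mul, map_mul, h0, zero_mul] at h1
  exact absurd h1 (not_le.2 zero_lt_one)

/-- Locality enters here: the germ `a / b` is a non-unit of `O` at `h v`, so its pull back is a
non-unit of `O` at `v`. -/
lemma val_comorphism_lt {h : space Q ⟶ space P} (hl : PairRingedSpace.Hom.IsLocal h) (v : Val Q)
    (a b : P.B) (hab : (h.hom.hom.base v : Val P).1.val a < (h.hom.hom.base v : Val P).1.val b) :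
    v.1.val (comorphism h a) < v.1.val (comorphism h b) := by
  let w : Val P := h.hom.hom.base v
  have hb : w.1.val b ≠ 0 := (zero_le.trans_lt hab).ne'
  obtain ⟨c, hc⟩ := (Spa.not_bounded_iff _).1 w.2 b hb
  have hbc0 : w.1.val (b * c) ≠ 0 := (zero_lt_one.trans_le hc).ne'
  have hc0 : w.1.val c ≠ 0 := fun h0 => hbc0 (by rw [map_mul, h0, mul_zero])
  have habc : w.1.val (a * c) < w.1.val (b * c) := by
    rw [map_mul, map_mul]
    exact (mul_lt_mul_iff_left₀ (zero_lt_iff.2 hc0)).2 hab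
  -- the quotient `a / b` is expanded by `c` to make the denominator at least `1`
  obtain ⟨U, hU, s, hs, hsab⟩ := exists_section_div w (a * c) (b * c) habc.le hc
  have h0 := congrArg (stalkVal w) (hsab ⟨w, hU⟩)
  rw [map_mul, stalkVal_algebraMap, stalkVal_algebraMap] at h0
  have hlt : stalkVal w (s.1 ⟨w, hU⟩) < 1 := by
    by_contra! hge
    exact absurd (h0 ▸ habc) (not_lt.2 (le_mul_of_one_le_left' hge))
  have h1 := congrArg (stalkVal v) (evalAt_mul_eq h s (a * c) (b * c) hsab v hU)
  rw [map_mul, stalkVal_algebraMap, stalkVal_algebraMap] at h1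
  have h2 : v.1.val (comorphism h (a * c)) < v.1.val (comorphism h (b * c)) := by
    rw [← h1]
    exact mul_lt_of_lt_one_left (zero_lt_iff.2 (val_comorphism_ne_zero h v _ hbc0))
      ((isLocal_iff h).1 hl U s hs v hU hlt)
  rw [map_mul, map_mul, map_mul, map_mul] at h2
  exact lt_of_mul_lt_mul_right' h2

/-- A local morphism `h` is given on points by `v ↦ r(v ∘ φ)`, where `φ` is its comorphism. -/
lemma base_le_iff {h : space Q ⟶ space P} (hl : PairRingedSpace.Hom.IsLocal h) (v : Val Q)
    (a b : P.B) : (h.hom.hom.base v : Val P).1.val a ≤ (h.hom.hom.base v : Val P).1.val b ↔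
      ((∃ c, 1 ≤ v.1.val (comorphism h (a * c))) →
        v.1.val (comorphism h a) ≤ v.1.val (comorphism h b)) := by
  let w : Val P := h.hom.hom.base v
  constructor
  · rintro hab ⟨c, hc⟩
    have hac : 1 ≤ w.1.val (a * c) := by
      by_contra! hlt
      rw [← map_one w.1.val] at hlt
      have := val_comorphism_lt hl v _ _ hlt
      rw [map_one, map_one] at this
      exact absurd hc (not_le.2 this)
    have hbc : w.1.val (a * c) ≤ w.1.val (b * c) := by
      rw [map_mul, map_mul]
      exact mul_le_mul_left hab _
    have h1 := val_comorphism_le h v (a * c) (b * c) hbc (hac.trans hbc)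
    rw [map_mul, map_mul, map_mul, map_mul] at h1
    refine le_of_mul_le_mul_right h1 (zero_lt_iff.2 fun h0 => ?_)
    rw [map_mul, map_mul, h0, mul_zero] at hc
    exact absurd hc (not_le.2 zero_lt_one)
  · intro H
    by_contra! hlt
    have ha : w.1.val a ≠ 0 := (zero_le.trans_lt hlt).ne'
    obtain ⟨c, hc⟩ := (Spa.not_bounded_iff _).1 w.2 a ha
    exact absurd (H ⟨c, one_le_val_comorphism h v _ hc⟩)
      (not_le.2 (val_comorphism_lt hl v _ _ hlt))

/-- A local morphism is determined by its comorphism. -/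
lemma ext_of_comorphism_eq {h k : space Q ⟶ space P} (hh : PairRingedSpace.Hom.IsLocal h)
    (hk : PairRingedSpace.Hom.IsLocal k) (e : comorphism h = comorphism k) : h = k := by
  have hbase : ∀ v : Val Q, h.hom.hom.base v = k.hom.hom.base v := fun v =>
    Subtype.ext (Spa.ext_val fun a b => by
      refine (base_le_iff hh v a b).trans ?_
      rw [e]
      exact (base_le_iff hk v a b).symm)
  refine hom_ext hbase fun U s v hv hv' => ?_
  show evalAt h U v hv s = evalAt k U v hv' s
  obtain ⟨V, hvV, hVU, D, hD, x, -, hx⟩ := s.2 _ hv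
  obtain ⟨g, n, hgn⟩ := D.exists_germ_mul_pow_eq x
  have hvV' : k.hom.hom.base v ∈ V := hbase v ▸ hvV
  let t : sectionsM P V := ⟨fun w => s.1 ⟨w.1, hVU w.2⟩, IsSection.res hVU s.2⟩
  have ht : ∀ w : V, t.1 w * algebraMap P.B _ (D.b ^ n) = algebraMap P.B _ g := fun w => by
    rw [← hgn w.1 (hD _ w.2), ← hx w.1 w.2]
  have h1 := evalAt_mul_eq h t _ _ ht v hvV
  have h2 := evalAt_mul_eq k t _ _ ht v hvV'
  rw [evalAt_res h hVU v hvV s] at h1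
  rw [evalAt_res k hVU v hvV' s, ← e, ← h1] at h2
  have hb : v.1.val (comorphism h (D.b ^ n)) ≠ 0 := by
    refine val_comorphism_ne_zero h v _ ?_
    rw [map_pow]
    exact pow_ne_zero _ (RatDatum.val_b_ne_zero (hD _ hvV))
  have hu : IsUnit (algebraMap Q.B (Localization.AtPrime v.1.ker) (comorphism h (D.b ^ n))) :=
    IsLocalization.map_units _ (⟨_, fun h0 => hb (Spa.mem_ker.1 h0)⟩ : v.1.ker.primeCompl)
  exact (hu.mul_right_cancel h2).symm

lemma comorphism_birHom (φ : P ⟶ Q) : comorphism (birHom φ) = φ.toRingHom :=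
  (comorphism_eq_iff _ _).2 fun x =>
    Subtype.ext (funext fun v => stalkHom_algebraMap φ v.1 _ rfl x)

lemma comorphism_comp (h : space R ⟶ space Q) (k : space Q ⟶ space P) :
    comorphism (h ≫ k) = (comorphism h).comp (comorphism k) :=
  (comorphism_eq_iff _ _).2 fun x => by
    rw [RingHom.comp_apply, toGlobal_comorphism, toGlobal_comorphism]
    rfl

lemma comorphism_id : comorphism (𝟙 (space P)) = RingHom.id P.B :=
  (comorphism_eq_iff _ _).2 fun _ => rfl

end Val

/-! ### Relative normalizations -/

lemma PaRing.nor_nor (P : PaRing.{u}) : P.nor.nor.A = P.nor.A := by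
  have key : ∀ x : P.B, x ∈ integralClosure (integralClosure P.A P.B) P.B →
      x ∈ integralClosure P.A P.B := fun x hx => by
    rw [integralClosure_idem] at hx
    obtain ⟨y, rfl⟩ := Algebra.mem_bot.1 hx
    exact y.2
  exact Subring.ext fun x => ⟨fun hx => key x hx, fun hx => P.nor.le_nor hx⟩

namespace Val

lemma val_le_one_of_mem_nor (v : Val P) {x : P.B} (hx : x ∈ P.nor.A) :
    v.1.val x ≤ v.1.val 1 := by
  rw [map_one, ← stalkVal_algebraMap v x]
  exact stalkVal_section_le (P := P) ((toGlobal_mem_O_iff (P := P) x).2 hx) ⟨v, trivial⟩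

/-- An unbounded `A`-valuation, regarded as a valuation bounded by `1` on `Nor_B A`. -/
def toNor (v : Val P) : Val P.nor :=
  ⟨⟨v.1.rel, fun x hx => (Spa.vle_iff v.1 x 1).2 (v.val_le_one_of_mem_nor hx)⟩, v.2⟩

lemma continuous_toNor : Continuous (toNor : Val P → Val P.nor) := by
  refine continuous_induced_rng.2 (continuous_generateFrom_iff.2 ?_)
  rintro _ ⟨a, b, rfl⟩
  have h : IsOpen {v : Spa P | v.val (a : P.B) ≤ v.val (b : P.B) ∧ v.val (b : P.B) ≠ 0} :=
    isOpen_generateFrom_of_mem ⟨a, b, rfl⟩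
  exact h.preimage continuous_subtype_val

/-- A rational domain datum for `(B, Nor_B A)`, regarded as one for `(B, A)`. -/
def _root_.Birational.RatDatum.ofNor (D : RatDatum P.nor) : RatDatum P :=
  ⟨D.b, D.T, D.finite, D.span_eq_top⟩

lemma _root_.Birational.RatDatum.mem_nor_ofNor (D : RatDatum P.nor) {x : D.pair.B}
    (hx : x ∈ D.pair.nor.A) : (x : D.ofNor.pair.B) ∈ D.ofNor.pair.nor.A := by
  have hA : D.pair.A ≤ D.ofNor.pair.nor.A := by
    refine (Subring.closure_le (t := D.ofNor.pair.nor.A)).2 ?_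
    rintro _ (⟨a, ha, rfl⟩ | ⟨a, ha, rfl⟩)
    · exact D.ofNor.algebraMap_mem_nor ha
    · exact PaRing.le_nor _ (Subring.subset_closure (Or.inr ⟨a, ha, rfl⟩))
  rw [← PaRing.nor_nor]
  obtain ⟨p, hp, h0⟩ := PaRing.mem_nor.1 hx
  refine ⟨p.map (Subring.inclusion hA), hp.map _, ?_⟩
  exact (Polynomial.eval₂_map _ _ (x : D.ofNor.pair.B)).trans h0

lemma IsSection.ofNor {N : ∀ D : RatDatum P.nor, Subring D.pair.B}
    {N' : ∀ D : RatDatum P, Subring D.pair.B} (hN : ∀ D, ∀ x ∈ N D, x ∈ N' D.ofNor)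
    {U : Opens (Val P.nor)} {s : ∀ w : U, Localization.AtPrime w.1.1.ker} (hs : IsSection N U s) :
    IsSection N' (⟨toNor ⁻¹' U, U.2.preimage continuous_toNor⟩ : Opens (Val P))
      (fun v => s ⟨toNor v.1, v.2⟩ : ∀ v : Opens.mk _ (U.2.preimage continuous_toNor),
        Localization.AtPrime v.1.1.ker) := by
  intro v hv
  obtain ⟨W, hvW, hWU, D, hD, x, hx, h⟩ := hs _ hv
  exact ⟨⟨toNor ⁻¹' W, W.2.preimage continuous_toNor⟩, hvW, fun w hw => hWU hw, D.ofNor,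
    fun w hw => hD _ hw, x, hN D x hx, fun w hw => h _ hw⟩

/-- The inverse of the morphism `Val(B, Nor_B A) → Val(B, A)`: it is the identity on valuations and
on the local rings of `B`. -/
noncomputable def toNorHom (P : PaRing.{u}) : space P ⟶ space P.nor where
  hom := InducedCategory.homMk
    { base := TopCat.ofHom ⟨toNor, continuous_toNor⟩
      c :=
        { app := fun _ => CommRingCat.ofHom
            { toFun := fun s => ⟨fun v => s.1 ⟨toNor v.1, v.2⟩,
                IsSection.ofNor (N' := fun _ => ⊤) (fun _ _ _ => trivial) s.2⟩
              map_one' := rfl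
              map_mul' := fun _ _ => rfl
              map_zero' := rfl
              map_add' := fun _ _ => rfl }
          naturality := fun _ _ _ => rfl } }
  map_O _ _ hs := IsSection.ofNor (fun D _ hx => D.mem_nor_ofNor hx) hs

lemma isLocal_toNorHom (P : PaRing.{u}) : PairRingedSpace.Hom.IsLocal (toNorHom P) :=
  (isLocal_iff _).2 fun _ _ _ _ _ h => h

lemma comorphism_toNorHom (P : PaRing.{u}) : comorphism (toNorHom P) = RingHom.id P.B :=
  (comorphism_eq_iff _ _).2 fun _ => rfl

end Val

/-! ### Morphisms of affinoid birational spaces -/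

/-- Passage to global sections, from morphisms `Val(B, A) → Val(B', A')` to homomorphisms
`(B', Nor_{B'} A') → (B, Nor_B A)`. -/
noncomputable def norComorphism (h : bir.obj (op P) ⟶ bir.obj (op Q)) : Q.nor ⟶ P.nor :=
  ⟨Val.comorphism (P := Q) (Q := P) h.1,
    fun _ hx => Val.comorphism_mem_nor (P := Q) (Q := P) h.1 hx⟩

lemma norComorphism_injective :
    Function.Injective (norComorphism : (bir.obj (op P) ⟶ bir.obj (op Q)) → (Q.nor ⟶ P.nor)) :=
  fun h k e => Subtype.ext
    (Val.ext_of_comorphism_eq (P := Q) (Q := P) h.2 k.2 (congrArg PaRing.Hom.toRingHom e))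

/-- The isomorphism between `Val(B, Nor_B A)` and `Val(B, A)`. -/
noncomputable def birToNorIso (P : PaRing.{u}) : bir.obj (op P.nor) ≅ bir.obj (op P) where
  hom := bir.map P.toNor.op
  inv := ⟨Val.toNorHom P, Val.isLocal_toNorHom P⟩
  hom_inv_id := Subtype.ext (Val.ext_of_comorphism_eq
    (PairRingedSpace.isLocal_comp _ _ (Val.birHom_isLocal P.toNor) (Val.isLocal_toNorHom P))
    (PairRingedSpace.isLocal_id _)
    (((Val.comorphism_comp _ _).trans (congrArg₂ RingHom.comp (Val.comorphism_birHom P.toNor)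
      (Val.comorphism_toNorHom P))).trans (Val.comorphism_id (P := P.nor)).symm))
  inv_hom_id := Subtype.ext (Val.ext_of_comorphism_eq
    (PairRingedSpace.isLocal_comp _ _ (Val.isLocal_toNorHom P) (Val.birHom_isLocal P.toNor))
    (PairRingedSpace.isLocal_id _)
    (((Val.comorphism_comp _ _).trans (congrArg₂ RingHom.comp (Val.comorphism_toNorHom P)
      (Val.comorphism_birHom P.toNor))).trans (Val.comorphism_id (P := P)).symm))

lemma norComorphism_surjective :
    Function.Surjective (norComorphism : (bir.obj (op P) ⟶ bir.obj (op Q)) → (Q.nor ⟶ P.nor)) := by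
  intro k
  refine ⟨(birToNorIso P).inv ≫ bir.map k.op ≫ (birToNorIso Q).hom, PaRing.Hom.ext ?_⟩
  refine (Val.comorphism_comp _ _).trans ?_
  refine (congrArg₂ RingHom.comp (Val.comorphism_toNorHom P)
    ((Val.comorphism_comp _ _).trans (congrArg₂ RingHom.comp (Val.comorphism_birHom k)
      (Val.comorphism_birHom Q.toNor)))).trans ?_
  rfl

/-! ### The localized category -/

lemma isInvertedBy_bir : PaRing.relNormalizations.{u}.IsInvertedBy bir.{u}.rightOp := by
  intro _ _ _ hw
  obtain ⟨P⟩ := hw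
  exact (birToNorIso _).op.isIso_hom

namespace PaRing

/-- The homomorphism `(B, Nor_B A) → (B', Nor_{B'} A')` induced by `(B, A) → (B', A')`. -/
def norMap (f : P ⟶ Q) : P.nor ⟶ Q.nor := ⟨f.toRingHom, fun _ hx => f.map_nor hx⟩

lemma relNormalizations_toNor (P : PaRing.{u}) : relNormalizations P.toNor :=
  MorphismProperty.ofHoms.mk P

/-- The property of a morphism of the localized category to be, up to relative normalizations, the
image of a homomorphism `(B, Nor_B A) → (B', Nor_{B'} A')`. -/
def IsInducedByNor (g : relNormalizations.{u}.Q.obj P ⟶ relNormalizations.{u}.Q.obj Q) : Prop :=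
  ∃ k : P.nor ⟶ Q.nor, g ≫ relNormalizations.Q.map Q.toNor =
    relNormalizations.Q.map P.toNor ≫ relNormalizations.Q.map k

lemma IsInducedByNor.comp {f : relNormalizations.{u}.Q.obj P ⟶ relNormalizations.{u}.Q.obj Q}
    {g : relNormalizations.{u}.Q.obj Q ⟶ relNormalizations.{u}.Q.obj R}
    (hf : IsInducedByNor f) (hg : IsInducedByNor g) : IsInducedByNor (f ≫ g) := by
  obtain ⟨k, hk⟩ := hf
  obtain ⟨l, hl⟩ := hg
  exact ⟨k ≫ l, by rw [Category.assoc, hl, reassoc_of% hk, Functor.map_comp]⟩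

lemma isInducedByNor_map (f : P ⟶ Q) : IsInducedByNor (relNormalizations.Q.map f) :=
  ⟨norMap f, (relNormalizations.Q.map_comp f Q.toNor).symm.trans
    (relNormalizations.Q.map_comp P.toNor (norMap f))⟩

/-- The formal inverse of `P.toNor` is induced by the identity of `P.B`, since `P.nor` is its own
normalization. -/
lemma isInducedByNor_wInv (P : PaRing.{u}) :
    IsInducedByNor (Localization.Construction.wInv P.toNor (relNormalizations_toNor P)) := by
  let k : P.nor.nor ⟶ P.nor := ⟨RingHom.id P.B, fun x hx => P.nor_nor ▸ hx⟩
  refine ⟨k, (Localization.Construction.wIso _ (relNormalizations_toNor P)).inv_hom_id.trans ?_⟩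
  exact (relNormalizations.Q.map_id _).symm.trans (relNormalizations.Q.map_comp P.nor.toNor k)

lemma isInducedByNor (g : relNormalizations.{u}.Q.obj P ⟶ relNormalizations.{u}.Q.obj Q) :
    IsInducedByNor g := by
  let T : MorphismProperty relNormalizations.{u}.Localization := fun X Y g =>
    IsInducedByNor (P := (Localization.Construction.objEquiv _).symm X)
      (Q := (Localization.Construction.objEquiv _).symm Y) g
  have : T.IsStableUnderComposition := ⟨fun _ _ hf hg => IsInducedByNor.comp hf hg⟩
  have hT : T = ⊤ := by
    refine Localization.Construction.morphismProperty_eq_top T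
      (fun X Y f => isInducedByNor_map f) fun X Y w hw => ?_
    obtain ⟨P⟩ := hw
    exact isInducedByNor_wInv _
  exact (hT ▸ MorphismProperty.top_apply g : T g)

end PaRing

/-- The functor from the localized category to the opposite of `af-Birat` induced by `bir`. -/
noncomputable abbrev birLift : PaRing.relNormalizations.{u}.Localization ⥤ AfBirat.{u}ᵒᵖ :=
  Localization.Construction.lift bir.{u}.rightOp isInvertedBy_bir

lemma birLift_map_Q (f : P ⟶ Q) :
    birLift.map (PaRing.relNormalizations.Q.map f) = (bir.map f.op).op := by
  have h := Functor.congr_hom (Localization.Construction.fac bir.{u}.rightOp isInvertedBy_bir) f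
  exact h.trans ((Category.id_comp _).trans (Category.comp_id _))

lemma isIso_Q_map_toNor (P : PaRing.{u}) : IsIso (PaRing.relNormalizations.Q.map P.toNor) :=
  PaRing.relNormalizations.Q_inverts _ (PaRing.relNormalizations_toNor P)

lemma norComorphism_map (k : P ⟶ Q) : (norComorphism (bir.map k.op)).toRingHom = k.toRingHom :=
  Val.comorphism_birHom k

lemma norComorphism_comp (f : bir.obj (op R) ⟶ bir.obj (op Q))
    (g : bir.obj (op Q) ⟶ bir.obj (op P)) :
    (norComorphism (f ≫ g)).toRingHom =
      (norComorphism f).toRingHom.comp (norComorphism g).toRingHom :=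
  Val.comorphism_comp f.1 g.1

/-- A preimage of `f` is the comorphism of `f`, a homomorphism of normalized pairs, conjugated by
relative normalizations. -/
lemma birLift_map_surjective (f : bir.obj (op Q) ⟶ bir.obj (op P)) :
    ∃ g : PaRing.relNormalizations.{u}.Q.obj P ⟶ PaRing.relNormalizations.Q.obj Q,
      birLift.map g = f.op := by
  have := isIso_Q_map_toNor P
  have := isIso_Q_map_toNor Q
  let k := norComorphism f
  refine ⟨PaRing.relNormalizations.Q.map P.toNor ≫ PaRing.relNormalizations.Q.map k ≫
    inv (PaRing.relNormalizations.Q.map Q.toNor), ?_⟩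
  rw [Functor.map_comp, Functor.map_comp, Functor.map_inv, ← Category.assoc]
  refine (IsIso.comp_inv_eq _).2 ?_
  rw [birLift_map_Q, birLift_map_Q, birLift_map_Q]
  refine Quiver.Hom.unop_inj (norComorphism_injective (PaRing.Hom.ext ?_))
  refine (norComorphism_comp (bir.map k.op) (bir.map P.toNor.op)).trans
    (Eq.trans ?_ (norComorphism_comp (bir.map Q.toNor.op) f).symm)
  rw [norComorphism_map, norComorphism_map, norComorphism_map]
  rfl

lemma birLift_map_injective
    {g₁ g₂ : PaRing.relNormalizations.{u}.Q.obj P ⟶ PaRing.relNormalizations.Q.obj Q}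
    (h : birLift.map g₁ = birLift.map g₂) : g₁ = g₂ := by
  have := isIso_Q_map_toNor P
  have := isIso_Q_map_toNor Q
  obtain ⟨k₁, h₁⟩ := PaRing.isInducedByNor g₁
  obtain ⟨k₂, h₂⟩ := PaRing.isInducedByNor g₂
  rw [← cancel_mono (PaRing.relNormalizations.Q.map Q.toNor), h₁, h₂]
  have e : birLift.map (PaRing.relNormalizations.Q.map P.toNor ≫ PaRing.relNormalizations.Q.map k₁) =
      birLift.map (PaRing.relNormalizations.Q.map P.toNor ≫ PaRing.relNormalizations.Q.map k₂) := by
    rw [← h₁, ← h₂, birLift.map_comp, birLift.map_comp, h]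
  rw [birLift.map_comp, birLift.map_comp, cancel_epi] at e
  rw [birLift_map_Q, birLift_map_Q] at e
  have e' : k₁ = k₂ := PaRing.Hom.ext (by
    rw [← norComorphism_map k₁, ← norComorphism_map k₂, Quiver.Hom.op_inj e])
  rw [e']

instance : birLift.{u}.Full where
  map_surjective {X Y} f :=
    birLift_map_surjective (P := (Localization.Construction.objEquiv _).symm X)
      (Q := (Localization.Construction.objEquiv _).symm Y) f.unop

instance : birLift.{u}.Faithful where
  map_injective {X Y} _ _ h :=
    birLift_map_injective (P := (Localization.Construction.objEquiv _).symm X)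
      (Q := (Localization.Construction.objEquiv _).symm Y) h

lemma PairRingedSpace.isLocal_of_iso {X Y : PairRingedSpace.{u}} (i : X ≅ Y) :
    PairRingedSpace.Hom.IsLocal i.hom := fun x => by
  let j : X.toO.toPresheafedSpace ≅ Y.toO.toPresheafedSpace :=
    { hom := (PairRingedSpace.Hom.toO i.hom).hom
      inv := (PairRingedSpace.Hom.toO i.inv).hom
      hom_inv_id := congrArg (fun f => (PairRingedSpace.Hom.toO f).hom) i.hom_inv_id
      inv_hom_id := congrArg (fun f => (PairRingedSpace.Hom.toO f).hom) i.inv_hom_id }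
  exact isLocalHom_of_iso (PresheafedSpace.stalkMap.stalkIso j x)

instance : birLift.{u}.EssSurj where
  mem_essImage X := by
    obtain ⟨P, ⟨i⟩⟩ := X.unop.isAffinoid
    let j : X.unop ≅ bir.obj (op P) :=
      { hom := ⟨i.hom, PairRingedSpace.isLocal_of_iso i⟩
        inv := ⟨i.inv, PairRingedSpace.isLocal_of_iso i.symm⟩
        hom_inv_id := Subtype.ext i.hom_inv_id
        inv_hom_id := Subtype.ext i.inv_hom_id }
    exact ⟨PaRing.relNormalizations.Q.obj P, ⟨j.op⟩⟩

end Birational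

theorem mainTheorem4 :
    (∃ h : PaRing.relNormalizations.{u}.IsInvertedBy bir.{u}.rightOp,
      (Localization.Construction.lift bir.{u}.rightOp h).IsEquivalence) ∧
    (∀ P : PaRing.{u}, Function.Bijective (toGlobal P) ∧
      ∀ x : P.B, toGlobal P x ∈ (Val.space P).O ⊤ ↔ x ∈ P.nor.A) ∧
    (∀ P P' : PaRing.{u},
      ∃ e : (bir.obj (op P) ⟶ bir.obj (op P')) ≃ (P'.nor ⟶ P.nor),
        ∀ (h : bir.obj (op P) ⟶ bir.obj (op P')) (x : P'.B),
          globalMap h.1 (toGlobal P' x) = toGlobal P ((e h).toRingHom x)) :=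
  ⟨⟨isInvertedBy_bir, { }⟩, fun P => ⟨toGlobal_bijective P, toGlobal_mem_O_iff⟩, fun P P' =>
    ⟨Equiv.ofBijective norComorphism ⟨norComorphism_injective, norComorphism_surjective⟩,
      fun h x => (Val.toGlobal_comorphism h.1 x).symm⟩⟩
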